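/- Let $d>0$ be a square-free integer, $F=\mathbb{Q}(\sqrt{-d})\subset\mathbb{C}$ (with $\operatorname{Im}\sqrt{-d}>0$), and let $p$ be a prime number that splits completely in $F$. Fix a field isomorphism $\mathbb{C}\simeq\overline{\mathbb{Q}}_p$, through which $\mathbb{Z}_p\subset\mathbb{Q}_p\subset\mathbb{C}$. Put $\theta=\frac{-1+\sqrt{-d}}{2}$ if $-d\equiv 1 \bmod 4$ and $\theta=\sqrt{-d}$ otherwise. Let $$\mathcal{D}=\{z\in\mathbb{C} : \operatorname{Im} z>0,\ |z|>1,\ -\tfrac12\le\operatorname{Re}z<\tfrac12\}\cup\{e^{i\varphi} : \tfrac{\pi}{2}\le\varphi\le\tfrac{2\pi}{3}\}.$$ The $\{\infty,p\}$-continued fraction algorithm applied to $\theta$ produces $x_1=\theta,x_2,x_3,\dots$ and matrices $A_k\in SL_2(\mathbb{Q})$, $k\ge 1$, as follows. Given $x_k$: * if $x_k\in\mathbb{Z}_p$, put $z_k=x_k$ and $D_k=\begin{pmatrix}1&0\\0&1\end{pmatrix}$; otherwise put $z_k=-1/x_k$ and $D_k=\begin{pmatrix}0&-1\\1&0\end{pmatrix}$;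 * let $a_k\in\{0,\dots,p^2-1\}$ be such that $z_k\equiv a_k \bmod p^2$ in $\mathbb{Z}_p$, and put $z_{k0}=(z_k-a_k)/p^2$ and $P_k=\begin{pmatrix}1/p&0\\0&p\end{pmatrix}\begin{pmatrix}1&-a_k\\0&1\end{pmatrix}$; * for $j=0,1,2,\dots$, as long as $z_{kj}\notin\mathcal{D}$, let $b_{kj}\in\mathbb{Z}$ be such that $-\frac12\le\operatorname{Re}(z_{kj}-b_{kj})<\frac12$, and put $z_{k,j+1}=-1/(z_{kj}-b_{kj})$ and $Q_{kj}=\begin{pmatrix}0&-1\\1&-b_{kj}\end{pmatrix}$; except that, if $z_{kj}=e^{\pi i/3}$ (a point outside $\mathcal{D}$ which $z\mapsto -1/(z-b)$ would fix), put $z_{k,j+1}=z_{kj}-1$ and $Q_{kj}=\begin{pmatrix}1&-1\\0&1\end{pmatrix}$. At the first $j$ with $z_{kj}\in\mathcal{D}$, put $x_{k+1}=z_{kj}$ and $Q_k=Q_{k,j-1}\cdots Q_{k0}$ (the identity if $j=0$). Put $A_k^{-1}=Q_kP_kD_k$ and $B_k=A_1\cdots A_k$. Then there is a smallest positive integer $N$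 with $x_{N+1}=x_1$. Write $B_N^{-1}=\begin{pmatrix}q_N&r_N\\s_N&t_N\end{pmatrix}$. The numbers $s=p^Ns_N$ and $t=p^Nt_N$ are integers, and the following hold (with $\mathbb{N}=\{0,1,2,\dots\}$). (i) If $-d\not\equiv1\bmod 4$, then for all $x,y\in\mathbb{Z}$ and $\nu\in\mathbb{N}$, the integers $x,y$ are relatively prime and satisfy $$x^2+dy^2=p^{2\nu}$$ if and only if there are a root of unity $\zeta\in F$, an $r\in\mathbb{N}$ and a choice of sign such that $$x+\sqrt{-d}\,y=\zeta\,(t\pm\sqrt{-d}\,s)^r\quad\text{and}\quad \nu=rN.$$ (ii) If $-d\equiv1\bmod 4$, then for all $x,y\in\mathbb{Z}$ and $\nu\in\mathbb{N}$, the integers $x,y$ are relatively prime and satisfy $$4x^2-4xy+(1+d)y^2=4p^{2\nu}$$ if and only if there are a root of unity $\zeta\in F$, an $r\in\mathbb{N}$ and a choice of sign such that $$x+\frac{-1+\sqrt{-d}}{2}\,y=\zeta\Bigl(t+\frac{-1\pm\sqrt{-d}}{2}\,s\Bigr)^r\quad\text{and}\quad \nu=rN.$$ -/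

import Mathlib

namespace InftyP

open scoped NumberField

noncomputable section

/-- The square root of `-d` in the upper half plane. -/
def sqrtNeg (d : ℕ) : ℂ := (Real.sqrt d : ℂ) * Complex.I

/-- The imaginary quadratic field `F = ℚ(√-d)`, as a subfield of `ℂ`. -/
def quadField (d : ℕ) : IntermediateField ℚ ℂ := IntermediateField.adjoin ℚ {sqrtNeg d}

/-- `θ = (-1 + √-d) / 2` if `-d ≡ 1 mod 4`, and `θ = √-d` otherwise. -/
def theta (d : ℕ) : ℂ :=
  if -(d : ℤ) ≡ 1 [ZMOD 4] then (-1 + sqrtNeg d) / 2 else sqrtNeg d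

/-- The rational prime `p` splits completely in the number field `K`: there are as many primes of
the ring of integers of `K` above `p` as the degree of `K`. -/
def SplitsCompletely (p : ℕ) (K : Type*) [Field K] [NumberField K] : Prop :=
  ((Ideal.span {(p : ℤ)}).primesOver (𝓞 K)).ncard = Module.finrank ℚ K

instance (d : ℕ) : NumberField (quadField d) where
  to_finiteDimensional := by
    refine IntermediateField.adjoin.finiteDimensional ?_
    refine ⟨Polynomial.X ^ 2 + Polynomial.C (d : ℚ),
      Polynomial.monic_X_pow_add_C _ two_ne_zero, ?_⟩
    have h : ((Real.sqrt d : ℝ) : ℂ) ^ 2 = (d : ℂ) := by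
      rw [← Complex.ofReal_pow, Real.sq_sqrt (Nat.cast_nonneg d), Complex.ofReal_natCast]
    simp [sqrtNeg, mul_pow, h]

/-- The fundamental domain `𝓓` for the action of `SL₂(ℤ)` on the upper half plane. -/
def fundDomain : Set ℂ :=
  {z | 0 < z.im ∧ 1 < ‖z‖ ∧ -(1 / 2) ≤ z.re ∧ z.re < 1 / 2} ∪
    {z | ∃ φ ∈ Set.Icc (Real.pi / 2) (2 * Real.pi / 3), z = Complex.exp (φ * Complex.I)}

/-! ### One loop of the `{∞, p}`-continued fraction algorithm

An isomorphism `ι` of `ℂ` with an algebraic closure of `ℚ_p` is fixed throughout. -/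

section Padic

variable {p : ℕ} [Fact p.Prime] (ι : ℂ ≃+* PadicAlgCl p)

/-- The complex number `z` lies in `ℤ_p` under the identification `ι`. -/
def IsPadicInt (z : ℂ) : Prop :=
  ∃ w : ℤ_[p], ι z = algebraMap ℚ_[p] (PadicAlgCl p) (w : ℚ_[p])

open Classical in
/-- Initialization: `x` if `x ∈ ℤ_p` (the case `δ = +1`), and `-1 / x` otherwise (`δ = -1`). -/
def initial (x : ℂ) : ℂ := if IsPadicInt ι x then x else -1 / x

/-- The `a ∈ {0, …, p² - 1}` with `z ≡ a mod p²` in `ℤ_p` (it is unique if `z ∈ ℤ_p`). -/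
def digit (z : ℂ) : ℕ := sInf {a : ℕ | a < p ^ 2 ∧ IsPadicInt ι ((z - a) / (p : ℂ) ^ 2)}

/-- The `p`-adic reduction `(z - a) / p²`. -/
def padicRed (z : ℂ) : ℂ := (z - digit ι z) / (p : ℂ) ^ 2

end Padic

/-- The integer `b` with `-1/2 ≤ Re (z - b) < 1/2`. -/
def nearest (z : ℂ) : ℤ := ⌊z.re + 1 / 2⌋

open Classical in
/-- One step of the `∞`-adic reduction: `z ↦ -1 / (z - b)`. The point `e^{πi/3}` is fixed by this
map and is not in `𝓓`; it is translated to `e^{πi/3} - 1 ∈ 𝓓` instead. -/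
def infNext (z : ℂ) : ℂ :=
  if z = Complex.exp (Real.pi / 3 * Complex.I) then z - 1 else -1 / (z - nearest z)

/-- The number of steps of the `∞`-adic reduction of `z`: the first `j` such that the `j`-th
iterate is in `𝓓`. -/
def infSteps (z : ℂ) : ℕ := sInf {j : ℕ | infNext^[j] z ∈ fundDomain}

/-- The matrix of a translation `z ↦ z - b`. -/
def transMat (b : ℚ) : Matrix.SpecialLinearGroup (Fin 2) ℚ :=
  ⟨!![1, -b; 0, 1], by simp [Matrix.det_fin_two]⟩

/-- The matrix of `z ↦ -1 / z`. -/
def invMat : Matrix.SpecialLinearGroup (Fin 2) ℚ :=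
  ⟨!![0, -1; 1, 0], by simp [Matrix.det_fin_two]⟩

/-- The matrix of `z ↦ -1 / (z - b)`. -/
def stepMat (b : ℚ) : Matrix.SpecialLinearGroup (Fin 2) ℚ :=
  ⟨!![0, -1; 1, -b], by simp [Matrix.det_fin_two]⟩

/-- The matrix `diag (1/p, p)` of `z ↦ z / p²`. -/
def scaleMat (p : ℕ) [Fact p.Prime] : Matrix.SpecialLinearGroup (Fin 2) ℚ :=
  ⟨!![1 / (p : ℚ), 0; 0, (p : ℚ)], by
    have : (p : ℚ) ≠ 0 := Nat.cast_ne_zero.mpr (Fact.out : p.Prime).ne_zero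
    simp [Matrix.det_fin_two, this]⟩

open Classical in
/-- The matrix of one step `infNext` of the `∞`-adic reduction at `z`. -/
def infStepMat (z : ℂ) : Matrix.SpecialLinearGroup (Fin 2) ℚ :=
  if z = Complex.exp (Real.pi / 3 * Complex.I) then transMat 1 else stepMat (nearest z)

/-- The matrix of the first `j` steps of the `∞`-adic reduction of `z`. -/
def infMat (z : ℂ) : ℕ → Matrix.SpecialLinearGroup (Fin 2) ℚ
  | 0 => 1
  | j + 1 => infStepMat (infNext^[j] z) * infMat z j

section Padic

variable {p : ℕ} [Fact p.Prime] (ι : ℂ ≃+* PadicAlgCl p)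

/-- One loop `x_k ↦ x_{k+1}` of the algorithm. -/
def next (x : ℂ) : ℂ :=
  infNext^[infSteps (padicRed ι (initial ι x))] (padicRed ι (initial ι x))

open Classical in
/-- The matrix `D` of the initialization at `x`. -/
def matD (x : ℂ) : Matrix.SpecialLinearGroup (Fin 2) ℚ := if IsPadicInt ι x then 1 else invMat

/-- The matrix `P` of the `p`-adic reduction in the loop starting at `x`. -/
def matP (x : ℂ) : Matrix.SpecialLinearGroup (Fin 2) ℚ :=
  scaleMat p * transMat (digit ι (initial ι x))

/-- The matrix `Q` of the `∞`-adic reduction in the loop starting at `x`. -/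
def matQ (x : ℂ) : Matrix.SpecialLinearGroup (Fin 2) ℚ :=
  infMat (padicRed ι (initial ι x)) (infSteps (padicRed ι (initial ι x)))

/-- The matrix `A` of the loop starting at `x`, so that `A⁻¹ = Q P D`. -/
def matA (x : ℂ) : Matrix.SpecialLinearGroup (Fin 2) ℚ := (matQ ι x * matP ι x * matD ι x)⁻¹

/-- The sequence of the algorithm started at `z`: `cfX ι z k` is `x_{k+1}`, so `cfX ι z 0 = z` is
`x_1`. -/
def cfX (z : ℂ) (k : ℕ) : ℂ := (next ι)^[k] z

/-- `B_k = A_1 ⋯ A_k`, where `A_k` is the matrix of the loop starting at `x_k`. -/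
def matB (z : ℂ) : ℕ → Matrix.SpecialLinearGroup (Fin 2) ℚ
  | 0 => 1
  | k + 1 => matB z k * matA ι (cfX ι z k)

end Padic

/-- `ζ` is a root of unity in the field `F = ℚ(√-d)`. -/
def IsRootOfUnityIn (d : ℕ) (ζ : ℂ) : Prop := ζ ∈ quadField d ∧ ∃ n : ℕ, 0 < n ∧ ζ ^ n = 1

end

end InftyP

namespace InftyP

/-! ### The complex numbers that are `p`-adic integers -/

section Padic

variable {p : ℕ} [Fact p.Prime] (ι : ℂ ≃+* PadicAlgCl p)

/-- The subring of complex numbers that are `p`-adic integers. -/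
noncomputable def padicRing : Subring ℂ :=
  ((algebraMap ℚ_[p] (PadicAlgCl p)).comp PadicInt.Coe.ringHom).range.comap (ι : ℂ →+* PadicAlgCl p)

variable {ι}

theorem isPadicInt_iff {z : ℂ} : IsPadicInt ι z ↔ z ∈ padicRing ι := by
  simp [IsPadicInt, padicRing, Subring.mem_comap, RingHom.mem_range, eq_comm]
  rfl

theorem natCast_p_ne_zero : (p : ℂ) ≠ 0 := Nat.cast_ne_zero.mpr (Fact.out : p.Prime).ne_zero

theorem mem_padicRing_of_eq {z : ℂ} (w : ℤ_[p])
    (h : ι z = algebraMap ℚ_[p] (PadicAlgCl p) (w : ℚ_[p])) : z ∈ padicRing ι :=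
  isPadicInt_iff.1 ⟨w, h⟩

theorem div_pow_mem_padicRing {z : ℂ} {w u : ℤ_[p]} {k : ℕ}
    (h : ι z = algebraMap ℚ_[p] (PadicAlgCl p) (w : ℚ_[p])) (hw : w = (p : ℤ_[p]) ^ k * u) :
    z / (p : ℂ) ^ k ∈ padicRing ι := by
  refine mem_padicRing_of_eq u ?_
  have hp : (p : PadicAlgCl p) ≠ 0 := by
    have := natCast_p_ne_zero (p := p)
    intro h0
    apply this
    apply ι.injective
    simpa using h0
  rw [map_div₀, h, hw]
  simp [hp]

/-- A `p`-adic integer is either divisible by `p` or a unit. -/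
theorem div_mem_or_inv_mem_padicRing {z : ℂ} (hz : z ∈ padicRing ι) :
    z / p ∈ padicRing ι ∨ z⁻¹ ∈ padicRing ι := by
  obtain ⟨w, hw⟩ := isPadicInt_iff.2 hz
  by_cases hu : IsUnit w
  · right
    obtain ⟨u, rfl⟩ := hu
    refine mem_padicRing_of_eq (↑u⁻¹ : ℤ_[p]) ?_
    rw [map_inv₀, hw, ← map_inv₀]
    congr 1
    refine inv_eq_of_mul_eq_one_right ?_
    rw [← PadicInt.coe_mul, Units.mul_inv, PadicInt.coe_one]
  · left
    have h1 : w ∈ IsLocalRing.maximalIdeal ℤ_[p] := (IsLocalRing.mem_maximalIdeal _).2 hu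
    rw [PadicInt.maximalIdeal_eq_span_p, Ideal.mem_span_singleton] at h1
    obtain ⟨u, hu⟩ := h1
    simpa using div_pow_mem_padicRing (k := 1) hw (by simpa using hu)

/-- A quotient of `p`-adic integers or its inverse is a `p`-adic integer. -/
theorem div_mem_or_div_mem_padicRing {x y : ℂ} (hx : x ∈ padicRing ι) (hy : y ∈ padicRing ι) :
    x / y ∈ padicRing ι ∨ y / x ∈ padicRing ι := by
  obtain ⟨a, ha⟩ := isPadicInt_iff.2 hx
  obtain ⟨b, hb⟩ := isPadicInt_iff.2 hy
  rcases le_total ‖(a / b : ℚ_[p])‖ 1 with h | h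
  · left
    refine mem_padicRing_of_eq ⟨a / b, h⟩ ?_
    rw [map_div₀, ha, hb, ← map_div₀]
  · right
    refine mem_padicRing_of_eq ⟨b / a, ?_⟩ ?_
    · rw [← inv_div, norm_inv]
      exact inv_le_one_of_one_le₀ h
    · rw [map_div₀, ha, hb, ← map_div₀]

theorem exists_natCast_sub_div_pow_mem {z : ℂ} (hz : z ∈ padicRing ι) (k : ℕ) :
    ∃ a : ℕ, a < p ^ k ∧ (z - a) / (p : ℂ) ^ k ∈ padicRing ι := by
  obtain ⟨w, hw⟩ := isPadicInt_iff.2 hz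
  refine ⟨w.appr k, w.appr_lt k, ?_⟩
  obtain ⟨u, hu⟩ := Ideal.mem_span_singleton.1 (PadicInt.appr_spec k w)
  refine div_pow_mem_padicRing (w := w - (w.appr k : ℤ_[p])) ?_ hu
  simp [hw]

theorem intCast_div_pow_mem_iff {m : ℤ} {k : ℕ} :
    (m : ℂ) / (p : ℂ) ^ k ∈ padicRing ι ↔ (p : ℤ) ^ k ∣ m := by
  have hp := pow_ne_zero k (natCast_p_ne_zero (p := p))
  constructor
  · intro h
    obtain ⟨w, hw⟩ := isPadicInt_iff.2 h
    rw [← PadicInt.pow_p_dvd_int_iff]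
    refine ⟨w, ?_⟩
    apply Subtype.ext
    apply (algebraMap ℚ_[p] (PadicAlgCl p)).injective
    have h2 : ι ((p : ℂ) ^ k * (m / (p : ℂ) ^ k)) = ι m := by rw [mul_div_cancel₀ _ hp]
    rw [map_mul, hw] at h2
    simpa using h2.symm
  · rintro ⟨n, rfl⟩
    have : (((p : ℤ) ^ k * n : ℤ) : ℂ) / (p : ℂ) ^ k = n := by
      push_cast
      field_simp
    rw [this]
    exact intCast_mem _ _

theorem inv_p_notMem_padicRing : ((p : ℂ))⁻¹ ∉ padicRing ι := by
  intro h
  have : ((1 : ℤ) : ℂ) / (p : ℂ) ^ 1 ∈ padicRing ι := by simpa using h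
  rw [intCast_div_pow_mem_iff, pow_one] at this
  exact (Nat.prime_iff_prime_int.1 (Fact.out : p.Prime)).not_isUnit (isUnit_of_dvd_one this)

theorem inv_mem_padicRing_of_not_div_mem {z : ℂ} (hz : z ∈ padicRing ι)
    (h : z / p ∉ padicRing ι) : z⁻¹ ∈ padicRing ι :=
  (div_mem_or_inv_mem_padicRing hz).resolve_left h

theorem not_div_mem_of_inv_mem_padicRing {z : ℂ} (hz0 : z ≠ 0) (h : z⁻¹ ∈ padicRing ι) :
    z / p ∉ padicRing ι := by
  intro h'
  apply inv_p_notMem_padicRing (ι := ι)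
  have := mul_mem h h'
  rwa [show z⁻¹ * (z / p) = (p : ℂ)⁻¹ by field_simp] at this

theorem digit_spec {z : ℂ} (hz : z ∈ padicRing ι) :
    (z - digit ι z) / (p : ℂ) ^ 2 ∈ padicRing ι := by
  have hne : {a : ℕ | a < p ^ 2 ∧ IsPadicInt ι ((z - a) / (p : ℂ) ^ 2)}.Nonempty := by
    obtain ⟨a, h1, h2⟩ := exists_natCast_sub_div_pow_mem hz 2
    exact ⟨a, h1, isPadicInt_iff.2 h2⟩
  exact isPadicInt_iff.1 (Nat.sInf_mem hne).2

/-- A complex root of an integral quadratic polynomial that has a simple root modulo `p` is a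
`p`-adic integer. -/
theorem mem_padicRing_of_simple_root {θ : ℂ} {e q : ℤ} (hθ : θ ^ 2 + e * θ + q = 0) {a : ℤ}
    (ha : (p : ℤ) ∣ a ^ 2 + e * a + q) (ha' : ¬ (p : ℤ) ∣ 2 * a + e) : θ ∈ padicRing ι := by
  let f : Polynomial ℤ := Polynomial.X ^ 2 + Polynomial.C e * Polynomial.X + Polynomial.C q
  have hev : ∀ z : ℤ_[p], f.aeval z = z ^ 2 + e * z + q := by
    intro z; simp [f]
  have hder : f.derivative.aeval (a : ℤ_[p]) = ((2 * a + e : ℤ) : ℤ_[p]) := by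
    have h2 : Polynomial.aeval (a : ℤ_[p]) (2 : Polynomial ℤ) = 2 := map_ofNat _ 2
    simp [f, h2]
  have hn1 : ‖f.derivative.aeval (a : ℤ_[p])‖ = 1 := by
    rw [hder]
    refine le_antisymm (PadicInt.norm_le_one _) ?_
    by_contra! h
    exact ha' ((PadicInt.norm_int_lt_one_iff_dvd _).1 h)
  have hn2 : ‖f.aeval (a : ℤ_[p])‖ < 1 := by
    rw [hev]
    have := (PadicInt.norm_int_lt_one_iff_dvd _).2 ha
    push_cast at this
    exact this
  obtain ⟨ρ, hρ, -⟩ := hensels_lemma (F := f) (a := (a : ℤ_[p])) (by rw [hn1]; simpa using hn2)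
  rw [hev] at hρ
  have h1 : (ι θ) ^ 2 + e * ι θ + q = 0 := by
    have := congrArg ι hθ
    simpa using this
  have h2 : (algebraMap ℚ_[p] (PadicAlgCl p) ρ) ^ 2 + e * algebraMap ℚ_[p] (PadicAlgCl p) ρ + q
      = 0 := by
    have := congrArg (fun x : ℤ_[p] => algebraMap ℚ_[p] (PadicAlgCl p) x) hρ
    simpa using this
  have h3 : (ι θ - algebraMap ℚ_[p] (PadicAlgCl p) ρ) *
      (ι θ - algebraMap ℚ_[p] (PadicAlgCl p) ((-e - ρ : ℤ_[p]) : ℚ_[p])) = 0 := by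
    have h4 : algebraMap ℚ_[p] (PadicAlgCl p) ((-e - ρ : ℤ_[p]) : ℚ_[p]) =
        -e - algebraMap ℚ_[p] (PadicAlgCl p) ρ := by simp
    rw [h4]
    linear_combination h1 - h2
  rcases mul_eq_zero.1 h3 with h | h
  · exact mem_padicRing_of_eq ρ (sub_eq_zero.1 h)
  · exact mem_padicRing_of_eq _ (sub_eq_zero.1 h)

end Padic

end InftyP

namespace InftyP
open scoped NumberField

/-! ### The ring of integers of an imaginary quadratic field and its split primes -/

theorem sqrtNeg_sq (d : ℕ) : sqrtNeg d ^ 2 = -(d : ℂ) := by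
  have h : ((Real.sqrt d : ℝ) : ℂ) ^ 2 = (d : ℂ) := by
    rw [← Complex.ofReal_pow, Real.sq_sqrt (Nat.cast_nonneg d), Complex.ofReal_natCast]
  simp [sqrtNeg, mul_pow, h]

theorem conj_sqrtNeg (d : ℕ) : (starRingEnd ℂ) (sqrtNeg d) = -sqrtNeg d := by
  simp [sqrtNeg]

theorem sqrtNeg_mem (d : ℕ) : sqrtNeg d ∈ quadField d :=
  IntermediateField.mem_adjoin_simple_self ℚ _

theorem isIntegral_sqrtNeg (d : ℕ) : IsIntegral ℤ (sqrtNeg d) := by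
  refine ⟨Polynomial.X ^ 2 + Polynomial.C (d : ℤ),
    Polynomial.monic_X_pow_add_C _ two_ne_zero, ?_⟩
  simp [sqrtNeg_sq]

theorem exists_rat_of_mem_quadField {d : ℕ} {z : ℂ} (hz : z ∈ quadField d) :
    ∃ a b : ℚ, z = a + b * sqrtNeg d := by
  have hint : IsIntegral ℚ (sqrtNeg d) := (isIntegral_sqrtNeg d).tower_top
  have hz' : z ∈ Algebra.adjoin ℚ {sqrtNeg d} := by
    rw [← IntermediateField.adjoin_simple_toSubalgebra_of_isAlgebraic hint.isAlgebraic]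
    exact hz
  induction hz' using Algebra.adjoin_induction with
  | mem x hx => exact ⟨0, 1, by simpa using hx⟩
  | algebraMap r => exact ⟨r, 0, by simp⟩
  | add x y hx hy h1 h2 =>
    obtain ⟨a, b, rfl⟩ := h1 (by
      change _ ∈ (quadField d).toSubalgebra
      rwa [quadField, IntermediateField.adjoin_simple_toSubalgebra_of_isAlgebraic hint.isAlgebraic])
    obtain ⟨a', b', rfl⟩ := h2 (by
      change _ ∈ (quadField d).toSubalgebra
      rwa [quadField, IntermediateField.adjoin_simple_toSubalgebra_of_isAlgebraic hint.isAlgebraic])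
    exact ⟨a + a', b + b', by push_cast; ring⟩
  | mul x y hx hy h1 h2 =>
    obtain ⟨a, b, rfl⟩ := h1 (by
      change _ ∈ (quadField d).toSubalgebra
      rwa [quadField, IntermediateField.adjoin_simple_toSubalgebra_of_isAlgebraic hint.isAlgebraic])
    obtain ⟨a', b', rfl⟩ := h2 (by
      change _ ∈ (quadField d).toSubalgebra
      rwa [quadField, IntermediateField.adjoin_simple_toSubalgebra_of_isAlgebraic hint.isAlgebraic])
    exact ⟨a * a' - d * b * b', a * b' + a' * b, by
      push_cast
      linear_combination (b : ℂ) * b' * sqrtNeg_sq d⟩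

theorem exists_int_of_isIntegral_rat {r : ℚ} (h : IsIntegral ℤ (r : ℂ)) : ∃ m : ℤ, r = m := by
  have h1 : IsIntegral ℤ r := by
    have : IsIntegral ℤ (algebraMap ℚ ℂ r) := by simpa using h
    exact (isIntegral_algebraMap_iff (algebraMap ℚ ℂ).injective).1 this
  obtain ⟨m, hm⟩ := IsIntegrallyClosed.isIntegral_iff.1 h1
  exact ⟨m, by simpa using hm.symm⟩

theorem exists_int_of_squarefree_mul_sq {d : ℕ} (hd : Squarefree d) {c : ℚ} {n : ℤ}
    (h : d * c ^ 2 = n) : ∃ k : ℤ, c = k := by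
  have hden : (c.den : ℤ) * c.den ∣ (d : ℤ) := by
    have h1 : (d : ℤ) * c.num ^ 2 = n * c.den ^ 2 := by
      have h0 : (c.den : ℚ) ≠ 0 := by exact_mod_cast c.den_nz
      rw [← Rat.num_div_den c] at h
      field_simp at h
      rw [mul_comm (n : ℤ)]
      exact_mod_cast h
    have hcop : IsCoprime ((c.den : ℤ) * c.den) (c.num ^ 2) := by
      rw [← sq]
      refine IsCoprime.pow ?_
      rw [Int.isCoprime_iff_gcd_eq_one, Int.gcd_comm]
      simpa [Int.gcd] using c.reduced
    refine hcop.dvd_of_dvd_mul_right ⟨n, ?_⟩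
    rw [h1]; ring
  have hu : IsUnit c.den := by
    refine hd _ ?_
    exact_mod_cast hden
  refine ⟨c.num, ?_⟩
  rw [Nat.isUnit_iff] at hu
  exact (Rat.den_eq_one_iff c).1 hu |>.symm

theorem four_not_dvd_of_squarefree {d : ℕ} (hd : Squarefree d) : ¬ 4 ∣ d := by
  intro h
  have := hd 2 (by simpa using h)
  simp at this

/-- The integral elements of `ℚ(√-d)` are the integral combinations of `1` and `θ`. -/
theorem exists_int_theta_of_isIntegral {d : ℕ} (hd : Squarefree d) {z : ℂ} (hz : z ∈ quadField d)
    (hint : IsIntegral ℤ z) : ∃ m n : ℤ, z = m + n * theta d := by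
  obtain ⟨a, b, rfl⟩ := exists_rat_of_mem_quadField hz
  have hconj : IsIntegral ℤ ((a : ℂ) - b * sqrtNeg d) := by
    have := hint.map (starRingEnd ℂ).toIntAlgHom
    simpa [conj_sqrtNeg, sub_eq_add_neg] using this
  obtain ⟨m, hm⟩ : ∃ m : ℤ, 2 * a = m := by
    apply exists_int_of_isIntegral_rat
    have h2 : ((2 * a : ℚ) : ℂ) = (a + b * sqrtNeg d) + (a - b * sqrtNeg d) := by
      push_cast; ring
    rw [h2]
    exact hint.add hconj
  obtain ⟨n, hn⟩ : ∃ n : ℤ, a ^ 2 + d * b ^ 2 = n := by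
    apply exists_int_of_isIntegral_rat
    have h2 : ((a ^ 2 + d * b ^ 2 : ℚ) : ℂ) = (a + b * sqrtNeg d) * (a - b * sqrtNeg d) := by
      push_cast
      linear_combination (b : ℂ) ^ 2 * sqrtNeg_sq d
    rw [h2]
    exact hint.mul hconj
  obtain ⟨k, hk⟩ : ∃ k : ℤ, 2 * b = k := by
    refine exists_int_of_squarefree_mul_sq hd (n := 4 * n - m ^ 2) ?_
    push_cast
    rw [← hn, ← hm]; ring
  have hmk : m ^ 2 + d * k ^ 2 = 4 * n := by
    have : (m ^ 2 + d * k ^ 2 : ℚ) = 4 * n := by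
      rw [← hn, ← hm, ← hk]; ring
    exact_mod_cast this
  have ha : (a : ℂ) = m / 2 := by
    have : a = m / 2 := by linarith
    rw [this]; push_cast; ring
  have hb : (b : ℂ) = k / 2 := by
    have : b = k / 2 := by linarith
    rw [this]; push_cast; ring
  have h4 : ¬ (4 : ℤ) ∣ d := by
    have := four_not_dvd_of_squarefree hd
    omega
  have key : ∀ x y : ℤ, (2 * x + 1) ^ 2 + d * (2 * y) ^ 2 ≠ 4 * n := by
    intro x y h
    have : 4 * (x ^ 2 + x + d * y ^ 2) + 1 = 4 * n := by linear_combination h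
    omega
  have key2 : ∀ x y : ℤ, (2 * x) ^ 2 + d * (2 * y + 1) ^ 2 ≠ 4 * n := by
    intro x y h
    apply h4
    exact ⟨n - x ^ 2 - d * (y ^ 2 + y), by linear_combination h⟩
  by_cases hmod : -(d : ℤ) ≡ 1 [ZMOD 4]
  · have hpar : (m + k) % 2 = 0 := by
      rcases Int.even_or_odd' m with ⟨x, rfl | rfl⟩ <;> rcases Int.even_or_odd' k with ⟨y, rfl | rfl⟩
      · omega
      · exact absurd hmk (key2 x y)
      · exact absurd hmk (key x y)
      · omega
    obtain ⟨l, hl⟩ := Int.dvd_of_emod_eq_zero hpar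
    refine ⟨l, k, ?_⟩
    have hl' : (m : ℂ) + k = 2 * l := by exact_mod_cast hl
    rw [theta, if_pos hmod, ha, hb]
    linear_combination hl' / 2
  · have hpar : m % 2 = 0 ∧ k % 2 = 0 := by
      rcases Int.even_or_odd' m with ⟨x, rfl | rfl⟩ <;> rcases Int.even_or_odd' k with ⟨y, rfl | rfl⟩
      · omega
      · exact absurd hmk (key2 x y)
      · exact absurd hmk (key x y)
      · exfalso
        apply hmod
        have h5 : 4 * (x ^ 2 + x + d * (y ^ 2 + y)) + 1 + d = 4 * n := by linear_combination hmk
        rw [Int.modEq_iff_dvd]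
        omega
    obtain ⟨l, hl⟩ := Int.dvd_of_emod_eq_zero hpar.1
    obtain ⟨l', hl'⟩ := Int.dvd_of_emod_eq_zero hpar.2
    refine ⟨l, l', ?_⟩
    rw [theta, if_neg hmod, ha, hb, hl, hl']
    push_cast; ring

theorem theta_mem (d : ℕ) : theta d ∈ quadField d := by
  have h := sqrtNeg_mem d
  unfold theta
  split_ifs
  · refine div_mem (add_mem (neg_mem (one_mem _)) h) ?_
    exact ofNat_mem (quadField d) 2
  · exact h

theorem intCast_add_mul_theta_mem (d : ℕ) (m n : ℤ) : m + n * theta d ∈ quadField d :=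
  add_mem (intCast_mem _ _) (mul_mem (intCast_mem _ _) (theta_mem d))

theorem one_lt_finrank_quadField {d : ℕ} (hd : Squarefree d) :
    1 < Module.finrank ℚ (quadField d) := by
  by_contra! h
  have hpos : 0 < Module.finrank ℚ (quadField d) := Module.finrank_pos
  have h1 : quadField d = ⊥ := IntermediateField.finrank_eq_one_iff.1 (by omega)
  have h2 := sqrtNeg_mem d
  rw [h1, IntermediateField.mem_bot] at h2
  obtain ⟨r, hr⟩ := h2
  have h3 := congrArg Complex.im hr
  have hd0 : (0 : ℝ) < d := by exact_mod_cast Nat.pos_of_ne_zero hd.ne_zero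
  simp [sqrtNeg] at h3
  have := Real.sqrt_pos.2 hd0
  linarith

/-- If `p` splits in `ℚ(√-d)` then the minimal polynomial of `θ` has a simple root modulo `p`. -/
theorem exists_simple_root_of_splits {p : ℕ} [Fact p.Prime] {d : ℕ} (hd : Squarefree d)
    (hsplit : SplitsCompletely p (quadField d)) {e q : ℤ}
    (hθ : theta d ^ 2 + e * theta d + q = 0) :
    ∃ a : ℤ, (p : ℤ) ∣ a ^ 2 + e * a + q ∧ ¬ (p : ℤ) ∣ 2 * a + e := by
  have hp : Prime (p : ℤ) := Nat.prime_iff_prime_int.1 Fact.out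
  have hcard : 1 < ((Ideal.span {(p : ℤ)}).primesOver (𝓞 (quadField d))).ncard := by
    rw [hsplit]; exact one_lt_finrank_quadField hd
  obtain ⟨P, hP, Q, hQ, hPQ⟩ := (Set.one_lt_ncard (Set.finite_of_ncard_pos (by omega))).1 hcard
  obtain ⟨P, Q, hP, hQ, hPQ⟩ : ∃ P Q : Ideal (𝓞 (quadField d)),
      P ∈ (Ideal.span {(p : ℤ)}).primesOver (𝓞 (quadField d)) ∧
      Q ∈ (Ideal.span {(p : ℤ)}).primesOver (𝓞 (quadField d)) ∧ ¬ P ≤ Q := by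
    by_cases h : P ≤ Q
    · exact ⟨Q, P, hQ, hP, fun h' => hPQ (le_antisymm h h')⟩
    · exact ⟨P, Q, hP, hQ, h⟩
  have hmem : ∀ I : Ideal (𝓞 (quadField d)),
      I ∈ (Ideal.span {(p : ℤ)}).primesOver (𝓞 (quadField d)) →
      ∀ m : ℤ, (m : 𝓞 (quadField d)) ∈ I ↔ (p : ℤ) ∣ m := by
    intro I hI m
    have h := hI.2.over
    have h2 : m ∈ Ideal.span {(p : ℤ)} ↔ algebraMap ℤ (𝓞 (quadField d)) m ∈ I := by
      rw [h]; exact Ideal.mem_comap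
    rw [Ideal.mem_span_singleton] at h2
    simpa using h2.symm
  have hPp := hP.1
  have hQp := hQ.1
  obtain ⟨β, hβP, hβQ⟩ := SetLike.not_le_iff_exists.1 hPQ
  obtain ⟨m, n, hmn⟩ := exists_int_theta_of_isIntegral hd (β : quadField d).2 (by
    have := NumberField.RingOfIntegers.isIntegral_coe β
    exact this.map (IsScalarTower.toAlgHom ℤ (quadField d) ℂ))
  have hθint : IsIntegral ℤ (theta d) := by
    refine ⟨Polynomial.X ^ 2 + Polynomial.C e * Polynomial.X + Polynomial.C q, ?_, ?_⟩
    · monicity!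
    · simp only [Polynomial.eval₂_add, Polynomial.eval₂_mul, Polynomial.eval₂_pow,
        Polynomial.eval₂_X, Polynomial.eval₂_C]
      simpa using hθ
  obtain ⟨t, ht⟩ : ∃ t : 𝓞 (quadField d), ((t : quadField d) : ℂ) = theta d := by
    refine ⟨⟨⟨theta d, theta_mem d⟩, ?_⟩, rfl⟩
    exact (isIntegral_algebraMap_iff (algebraMap (quadField d) ℂ).injective).1 hθint
  have hinj : ∀ x y : 𝓞 (quadField d), ((x : quadField d) : ℂ) = ((y : quadField d) : ℂ) → x = y :=
    fun x y h => NumberField.RingOfIntegers.ext (Subtype.ext h)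
  have hβ : β = m + n * t := by
    apply hinj
    rw [hmn, ← ht]
    simp
  have htq : t ^ 2 + e * t + q = 0 := by
    apply hinj
    have := hθ
    rw [← ht] at this
    simpa using this
  have hpn : ¬ (p : ℤ) ∣ n := by
    intro h
    have h1 : (n : 𝓞 (quadField d)) ∈ P := (hmem P hP n).2 h
    have h2 : (m : 𝓞 (quadField d)) ∈ P := by
      have : (m : 𝓞 (quadField d)) = β - n * t := by rw [hβ]; ring
      rw [this]
      exact sub_mem hβP (Ideal.mul_mem_right _ _ h1)
    apply hβQ
    rw [hβ]
    exact add_mem ((hmem Q hQ m).2 ((hmem P hP m).1 h2))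
      (Ideal.mul_mem_right _ _ ((hmem Q hQ n).2 h))
  obtain ⟨u, v, huv⟩ := (Irreducible.coprime_iff_not_dvd hp.irreducible).2 hpn
  have hpP : ((p : ℤ) : 𝓞 (quadField d)) ∈ P := (hmem P hP p).2 dvd_rfl
  have hpQ : ((p : ℤ) : 𝓞 (quadField d)) ∈ Q := (hmem Q hQ p).2 dvd_rfl
  have huv' : (u : 𝓞 (quadField d)) * (p : ℤ) + v * n = 1 := by exact_mod_cast huv
  have hta : t - ((-(v * m) : ℤ) : 𝓞 (quadField d)) ∈ P := by
    have : t - ((-(v * m) : ℤ) : 𝓞 (quadField d)) = v * β + u * t * (p : ℤ) := by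
      rw [hβ]; push_cast at huv' ⊢
      linear_combination (-t) * huv'
    rw [this]
    exact add_mem (Ideal.mul_mem_left _ _ hβP) (Ideal.mul_mem_left _ _ hpP)
  generalize hadef : -(v * m) = a at hta
  have hroot : (p : ℤ) ∣ a ^ 2 + e * a + q := by
    rw [← hmem P hP]
    have : ((a ^ 2 + e * a + q : ℤ) : 𝓞 (quadField d)) = -((t + a + e) * (t - a)) := by
      push_cast
      linear_combination htq
    rw [this]
    exact neg_mem (Ideal.mul_mem_left _ _ hta)
  refine ⟨a, hroot, fun hder => hβQ ?_⟩
  have htQ : t - (a : 𝓞 (quadField d)) ∈ Q := by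
    have : (t - (a : 𝓞 (quadField d))) ^ 2 ∈ Q := by
      have : (t - (a : 𝓞 (quadField d))) ^ 2 = -((a ^ 2 + e * a + q : ℤ) : 𝓞 (quadField d)) -
          ((2 * a + e : ℤ) : 𝓞 (quadField d)) * (t - a) := by
        push_cast
        linear_combination htq
      rw [this]
      exact sub_mem (neg_mem ((hmem Q hQ _).2 hroot))
        (Ideal.mul_mem_right _ _ ((hmem Q hQ _).2 hder))
    exact hQp.mem_of_pow_mem _ this
  have hma : ((m + n * a : ℤ) : 𝓞 (quadField d)) ∈ P := by
    have : ((m + n * a : ℤ) : 𝓞 (quadField d)) = β - n * (t - a) := by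
      rw [hβ]; push_cast; ring
    rw [this]
    exact sub_mem hβP (Ideal.mul_mem_left _ _ hta)
  have : β = ((m + n * a : ℤ) : 𝓞 (quadField d)) + n * (t - a) := by
    rw [hβ]; push_cast; ring
  rw [this]
  exact add_mem ((hmem Q hQ _).2 ((hmem P hP _).1 hma)) (Ideal.mul_mem_left _ _ htQ)

end InftyP

namespace InftyP

/-! ### The fundamental domain -/

theorem normSq_intCast_mul_add (z : ℂ) (m n : ℤ) :
    Complex.normSq (m * z + n) = m ^ 2 * (z.re ^ 2 + z.im ^ 2) + 2 * m * n * z.re + n ^ 2 := by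
  simp [Complex.normSq_apply]; ring

theorem finite_setOf_norm_le {z : ℂ} (hz : 0 < z.im) (r : ℝ) :
    {a : ℤ × ℤ | ‖(a.1 * z + a.2 : ℂ)‖ ≤ r}.Finite := by
  obtain ⟨A, hA⟩ := exists_nat_ge (r / z.im)
  obtain ⟨B, hB⟩ := exists_nat_ge (r + A * ‖z‖)
  refine (Set.finite_Icc ((-A : ℤ), (-B : ℤ)) ((A : ℤ), (B : ℤ))).subset ?_
  rintro ⟨m, n⟩ h
  simp only [Set.mem_ofPred_eq] at h
  have h1 : |(m : ℝ)| ≤ A := by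
    have h2 := (Complex.abs_im_le_norm _).trans h
    have h3 : (m * z + n : ℂ).im = m * z.im := by simp
    rw [h3, abs_mul, abs_of_pos hz, ← le_div_iff₀ hz] at h2
    exact h2.trans hA
  have h2 : |(n : ℝ)| ≤ B := by
    have h3 : ‖(n : ℂ)‖ ≤ ‖(m * z + n : ℂ)‖ + ‖(m * z : ℂ)‖ := by
      have := norm_sub_le (m * z + n : ℂ) (m * z)
      simpa using this
    have h4 : ‖(m * z : ℂ)‖ ≤ A * ‖z‖ := by
      rw [norm_mul, Complex.norm_intCast]
      gcongr
    rw [Complex.norm_intCast] at h3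
    linarith
  have h1' : |m| ≤ A := by exact_mod_cast h1
  have h2' : |n| ≤ B := by exact_mod_cast h2
  rw [abs_le] at h1' h2'
  exact ⟨⟨h1'.1, h2'.1⟩, ⟨h1'.2, h2'.2⟩⟩

theorem cos_two_pi_div_three : Real.cos (2 * Real.pi / 3) = -(1 / 2) := by
  rw [show 2 * Real.pi / 3 = Real.pi - Real.pi / 3 by ring, Real.cos_pi_sub, Real.cos_pi_div_three]

theorem mem_fundDomain_iff {z : ℂ} : z ∈ fundDomain ↔ 0 < z.im ∧ -(1 / 2) ≤ z.re ∧
    (1 < z.re ^ 2 + z.im ^ 2 ∧ z.re < 1 / 2 ∨ z.re ^ 2 + z.im ^ 2 = 1 ∧ z.re ≤ 0) := by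
  have hn : ‖z‖ ^ 2 = z.re ^ 2 + z.im ^ 2 := by
    rw [Complex.sq_norm, Complex.normSq_apply]; ring
  have hpi := Real.pi_pos
  constructor
  · rintro (⟨h1, h2, h3, h4⟩ | ⟨φ, ⟨h1, h2⟩, rfl⟩)
    · exact ⟨h1, h3, Or.inl ⟨by rw [← hn]; exact one_lt_pow₀ h2 two_ne_zero, h4⟩⟩
    · rw [Complex.exp_ofReal_mul_I_re, Complex.exp_ofReal_mul_I_im]
      refine ⟨Real.sin_pos_of_pos_of_lt_pi (by linarith) (by linarith), ?_,
        Or.inr ⟨by rw [Real.cos_sq_add_sin_sq], ?_⟩⟩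
      · rw [← cos_two_pi_div_three]
        exact Real.cos_le_cos_of_nonneg_of_le_pi (by linarith) (by linarith) h2
      · exact Real.cos_nonpos_of_pi_div_two_le_of_le h1 (by linarith)
  · rintro ⟨h1, h2, ⟨h3, h4⟩ | ⟨h3, h4⟩⟩
    · refine Or.inl ⟨h1, ?_, h2, h4⟩
      by_contra! h
      rw [← hn] at h3
      exact absurd h3 (not_lt.2 (pow_le_one₀ (norm_nonneg _) h))
    · refine Or.inr ⟨Real.arccos z.re, ⟨?_, ?_⟩, ?_⟩
      · rw [← Real.arccos_zero]; exact Real.arccos_le_arccos h4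
      · rw [← Real.arccos_cos (x := 2 * Real.pi / 3) (by linarith) (by linarith),
          cos_two_pi_div_three]
        exact Real.arccos_le_arccos h2
      · apply Complex.ext
        · rw [Complex.exp_ofReal_mul_I_re, Real.cos_arccos (by linarith) (by linarith)]
        · rw [Complex.exp_ofReal_mul_I_im, Real.sin_arccos,
            show 1 - z.re ^ 2 = z.im ^ 2 by linarith, Real.sqrt_sq h1.le]

theorem one_le_sq_sub_mul_add_sq {m n : ℤ} (h : m ≠ 0 ∨ n ≠ 0) : 1 ≤ m ^ 2 - |m * n| + n ^ 2 := by
  rw [abs_mul, ← sq_abs m, ← sq_abs n]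
  rcases h with h | h
  · have := abs_pos.2 h
    have h2 := abs_nonneg n
    nlinarith [sq_nonneg (|m| - |n|), sq_nonneg (2 * |n| - |m|)]
  · have := abs_pos.2 h
    have h2 := abs_nonneg m
    nlinarith [sq_nonneg (|m| - |n|), sq_nonneg (2 * |m| - |n|)]

theorem normSq_ge_of_mem_fundDomain {x : ℂ} (hx : x ∈ fundDomain) {m n : ℤ} :
    1 + m ^ 2 * (x.re ^ 2 + x.im ^ 2 - 1) ≤ Complex.normSq (m * x + n) ∨ (m = 0 ∧ n = 0) := by
  by_cases h0 : m = 0 ∧ n = 0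
  · exact Or.inr h0
  left
  rw [mem_fundDomain_iff] at hx
  have hre : |x.re| ≤ 1 / 2 := abs_le.2 ⟨hx.2.1, by rcases hx.2.2 with h | h <;> linarith [h.2]⟩
  have h1 : ((1 : ℤ) : ℝ) ≤ ((m ^ 2 - |m * n| + n ^ 2 : ℤ) : ℝ) :=
    Int.cast_le.2 (one_le_sq_sub_mul_add_sq (by tauto))
  push_cast at h1
  rw [normSq_intCast_mul_add]
  have h2 : |(m * n : ℝ) * x.re| ≤ |(m * n : ℝ)| * (1 / 2) := by
    rw [abs_mul]; gcongr
  have h3 := neg_abs_le ((m * n : ℝ) * x.re)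
  linarith

theorem im_eq_of_mul_eq {x x' c : ℂ} {m n m' n' : ℤ} (hc : c = m * x + n)
    (hcx : c * x' = m' * x + n') :
    x'.im * Complex.normSq c = ((m' * n - m * n' : ℤ) : ℝ) * x.im := by
  have h := congrArg (fun w => (w * (starRingEnd ℂ) c).im) hcx
  have h1 : (c * x' * (starRingEnd ℂ) c).im = x'.im * Complex.normSq c := by
    rw [mul_right_comm, Complex.mul_conj]; simp [mul_comm]
  simp only [h1] at h
  rw [h, hc]
  simp; ring

theorem lattice_eq_aux {x x' c : ℂ} (hx : x ∈ fundDomain) (hx' : x' ∈ fundDomain) (hc0 : c ≠ 0)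
    {m n m' n' : ℤ} (hc : c = m * x + n) (hcx : c * x' = m' * x + n') :
    1 + m ^ 2 * (x.re ^ 2 + x.im ^ 2 - 1) ≤ Complex.normSq c ∧
      x.im ≤ x'.im * Complex.normSq c := by
  have hpos := (mem_fundDomain_iff.1 hx).1
  have hpos' := (mem_fundDomain_iff.1 hx').1
  constructor
  · rcases normSq_ge_of_mem_fundDomain (m := m) (n := n) hx with h | ⟨rfl, rfl⟩
    · rwa [hc]
    · simp [hc0] at hc
  · have h := im_eq_of_mul_eq hc hcx
    rw [h]
    have h1 : 0 < x'.im * Complex.normSq c := mul_pos hpos' (Complex.normSq_pos.2 hc0)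
    rw [h] at h1
    have h2 : 0 < ((m' * n - m * n' : ℤ) : ℝ) := pos_of_mul_pos_left h1 hpos.le
    have h3 : (1 : ℝ) ≤ ((m' * n - m * n' : ℤ) : ℝ) := by
      exact_mod_cast Int.add_one_le_iff.2 (Int.cast_pos.1 h2)
    exact le_mul_of_one_le_left hpos.le h3

theorem eq_of_normSq_one {x x' c : ℂ} (hx : x ∈ fundDomain) (hx' : x' ∈ fundDomain)
    {m n m' n' : ℤ} (hc : c = m * x + n) (hcx : c * x' = m' * x + n')
    (h1 : Complex.normSq c = 1) (him : x.im = x'.im)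
    (hm : 1 + m ^ 2 * (x.re ^ 2 + x.im ^ 2 - 1) ≤ Complex.normSq c)
    (hgt : 1 < x.re ^ 2 + x.im ^ 2) : x = x' := by
  rw [mem_fundDomain_iff] at hx hx'
  have hm0 : m = 0 := by
    by_contra h0
    have : (0 : ℝ) < m ^ 2 := by positivity
    nlinarith
  subst hm0
  have hn : (n : ℝ) * n = 1 := by
    rw [hc] at h1
    simpa [Complex.normSq_apply] using h1
  have hnC : (n : ℂ) * n = 1 := by exact_mod_cast hn
  have hx'e : x' = ((n * m' : ℤ) : ℂ) * x + ((n * n' : ℤ) : ℂ) := by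
    rw [hc] at hcx
    push_cast at hcx ⊢
    linear_combination n * hcx - x' * hnC
  generalize n * m' = k at hx'e
  generalize n * n' = l at hx'e
  have hk : k = 1 := by
    have h2 := congrArg Complex.im hx'e
    simp only [Complex.add_im, Complex.mul_im, Complex.intCast_re, Complex.intCast_im, zero_mul,
      add_zero] at h2
    rw [← him] at h2
    have h3 : (k : ℝ) = 1 := mul_right_cancel₀ hx.1.ne' (by linarith)
    exact_mod_cast h3
  subst hk
  have h2 := congrArg Complex.re hx'e
  simp at h2
  have hb : x.re < 1 / 2 := by rcases hx.2.2 with h | h <;> linarith [h.2]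
  have hb' : x'.re < 1 / 2 := by rcases hx'.2.2 with h | h <;> linarith [h.2]
  have h3 : (l : ℝ) < 1 := by linarith [hx.2.1]
  have h4 : (-1 : ℝ) < l := by linarith [hx'.2.1]
  have h5 : l < 1 := by exact_mod_cast h3
  have h6 : -1 < l := by exact_mod_cast h4
  have h7 : l = 0 := by omega
  subst h7
  rw [hx'e]; simp

/-- Points of the fundamental domain that span homothetic lattices are equal. -/
theorem eq_of_homothetic {x x' c : ℂ} (hx : x ∈ fundDomain) (hx' : x' ∈ fundDomain) (hc0 : c ≠ 0)
    {m n m' n' k l k' l' : ℤ} (hc : c = m * x + n) (hcx : c * x' = m' * x + n')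
    (hi : c⁻¹ = k * x' + l) (hix : c⁻¹ * x = k' * x' + l') : x = x' := by
  obtain ⟨h1, h2⟩ := lattice_eq_aux hx hx' hc0 hc hcx
  obtain ⟨h3, h4⟩ := lattice_eq_aux hx' hx (inv_ne_zero hc0) hi hix
  have hx2 := mem_fundDomain_iff.1 hx
  have hx2' := mem_fundDomain_iff.1 hx'
  have hge : 1 ≤ x.re ^ 2 + x.im ^ 2 := by rcases hx2.2.2 with h | h <;> linarith [h.1]
  have hge' : 1 ≤ x'.re ^ 2 + x'.im ^ 2 := by rcases hx2'.2.2 with h | h <;> linarith [h.1]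
  have hpos := Complex.normSq_pos.2 hc0
  have ha : 1 ≤ Complex.normSq c :=
    le_trans (le_add_of_nonneg_right (mul_nonneg (sq_nonneg _) (sub_nonneg.2 hge))) h1
  have hb : 1 ≤ Complex.normSq c⁻¹ :=
    le_trans (le_add_of_nonneg_right (mul_nonneg (sq_nonneg _) (sub_nonneg.2 hge'))) h3
  have hone : Complex.normSq c = 1 := by
    rw [map_inv₀] at hb
    have := (one_le_inv₀ hpos).1 hb
    linarith
  have hone' : Complex.normSq c⁻¹ = 1 := by rw [map_inv₀, hone, inv_one]
  have him : x.im = x'.im := by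
    rw [hone] at h2
    rw [hone'] at h4
    linarith
  rcases hx2.2.2 with h | h
  · exact eq_of_normSq_one hx hx' hc hcx hone him h1 h.1
  rcases hx2'.2.2 with h' | h'
  · exact (eq_of_normSq_one hx' hx hi hix hone' him.symm h3 h'.1).symm
  refine Complex.ext ?_ him
  have h5 : x.re ^ 2 = x'.re ^ 2 := by
    have := h.1
    have := h'.1
    rw [him] at *
    linarith
  rcases sq_eq_sq_iff_eq_or_eq_neg.1 h5 with h6 | h6
  · exact h6
  · linarith [h.2, h'.2]

/-! ### The `∞`-adic reduction -/

theorem neg_one_div_im (w : ℂ) : (-1 / w).im = w.im / (w.re ^ 2 + w.im ^ 2) := by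
  rw [neg_div, one_div, Complex.neg_im, Complex.inv_im, Complex.normSq_apply]
  rw [neg_div, neg_neg, sq, sq]

theorem neg_one_div_re (w : ℂ) : (-1 / w).re = -w.re / (w.re ^ 2 + w.im ^ 2) := by
  rw [neg_div, one_div, Complex.neg_re, Complex.inv_re, Complex.normSq_apply, neg_div, sq, sq]

theorem eq_exp_iff {z : ℂ} (hz : 0 < z.im) :
    z = Complex.exp (Real.pi / 3 * Complex.I) ↔ z.re = 1 / 2 ∧ z.re ^ 2 + z.im ^ 2 = 1 := by
  have h : Complex.exp (Real.pi / 3 * Complex.I) =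
      Complex.exp ((Real.pi / 3 : ℝ) * Complex.I) := by push_cast; rfl
  have hre : (Complex.exp (Real.pi / 3 * Complex.I)).re = 1 / 2 := by
    rw [h, Complex.exp_ofReal_mul_I_re, Real.cos_pi_div_three]
  have him : (Complex.exp (Real.pi / 3 * Complex.I)).im = √3 / 2 := by
    rw [h, Complex.exp_ofReal_mul_I_im, Real.sin_pi_div_three]
  have h3 : (√3) ^ 2 = 3 := Real.sq_sqrt (by norm_num)
  constructor
  · rintro rfl
    rw [hre, him]
    exact ⟨rfl, by linarith⟩
  · rintro ⟨h1, h2⟩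
    refine Complex.ext (by rw [h1, hre]) ?_
    rw [him]
    rw [h1] at h2
    refine (pow_left_inj₀ hz.le (by positivity) two_ne_zero).1 ?_
    linarith

theorem sub_nearest_re (z : ℂ) :
    -(1 / 2) ≤ (z - nearest z).re ∧ (z - nearest z).re < 1 / 2 := by
  have h1 := Int.floor_le (z.re + 1 / 2)
  have h2 := Int.lt_floor_add_one (z.re + 1 / 2)
  simp only [Complex.sub_re, Complex.intCast_re, nearest]
  constructor <;> linarith

theorem nearest_eq_zero {z : ℂ} (h1 : -(1 / 2) ≤ z.re) (h2 : z.re < 1 / 2) : nearest z = 0 := by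
  rw [nearest, Int.floor_eq_zero_iff]
  constructor <;> linarith

theorem infNext_of_re {z : ℂ} (hz : 0 < z.im) (h1 : -(1 / 2) ≤ z.re) (h2 : z.re < 1 / 2) :
    infNext z = -1 / z := by
  rw [infNext, if_neg, nearest_eq_zero h1 h2]
  · simp
  · rw [eq_exp_iff hz]
    rintro ⟨h, -⟩
    linarith

theorem re_sq_add_im_sq_pos {w : ℂ} (hw : 0 < w.im) : 0 < w.re ^ 2 + w.im ^ 2 := by positivity

theorem infNext_im_pos {z : ℂ} (hz : 0 < z.im) : 0 < (infNext z).im := by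
  unfold infNext
  split_ifs
  · simpa using hz
  · have hw : 0 < (z - nearest z).im := by simpa using hz
    rw [neg_one_div_im]
    exact div_pos hw (re_sq_add_im_sq_pos hw)

theorem neg_one_div_neg_one_div {w : ℂ} : -1 / (-1 / w) = w := by
  rw [div_div_eq_mul_div]; ring

theorem exists_infNext_mem_of_one_le {w : ℂ} (hw : 0 < w.im) (h1 : -(1 / 2) ≤ w.re)
    (h2 : w.re < 1 / 2) (h : 1 ≤ w.re ^ 2 + w.im ^ 2) :
    ∃ j, infNext^[j] (-1 / w) ∈ fundDomain := by
  have hpos := re_sq_add_im_sq_pos hw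
  have hy : 0 < (-1 / w).im := by rw [neg_one_div_im]; exact div_pos hw hpos
  have hre := neg_one_div_re w
  have hback : ∀ _ : -(1 / 2) ≤ (-1 / w).re, ∀ _ : (-1 / w).re < 1 / 2,
      infNext^[1] (-1 / w) = w := by
    intro ha hb
    rw [Function.iterate_one, infNext_of_re hy ha hb, neg_one_div_neg_one_div]
  rcases h.lt_or_eq with hgt | heq
  · refine ⟨1, ?_⟩
    rw [hback, mem_fundDomain_iff]
    · exact ⟨hw, h1, Or.inl ⟨hgt, h2⟩⟩
    · rw [hre, le_div_iff₀ hpos]; linarith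
    · rw [hre, div_lt_iff₀ hpos]; linarith
  · rw [← heq, div_one] at hre
    have him : (-1 / w).im = w.im := by rw [neg_one_div_im, ← heq, div_one]
    by_cases h0 : 0 ≤ w.re
    · refine ⟨0, ?_⟩
      rw [Function.iterate_zero, id, mem_fundDomain_iff, hre, him]
      exact ⟨hw, by linarith, Or.inr ⟨by linarith, by linarith⟩⟩
    · push Not at h0
      refine ⟨1, ?_⟩
      rcases h1.lt_or_eq with hlt | he
      · rw [hback (by linarith) (by linarith), mem_fundDomain_iff]
        exact ⟨hw, h1, Or.inr ⟨heq.symm, h0.le⟩⟩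
      · rw [Function.iterate_one, infNext, if_pos, mem_fundDomain_iff]
        · simp only [Complex.sub_re, Complex.sub_im, Complex.one_re, Complex.one_im, hre, him,
            ← he]
          refine ⟨by linarith, by norm_num, Or.inr ⟨?_, by norm_num⟩⟩
          rw [← he] at heq
          linarith
        · rw [eq_exp_iff hy, hre, him, ← he]
          rw [← he] at heq
          exact ⟨by norm_num, by linarith⟩

/-- The numerator of the fractional linear action of a matrix in homogeneous coordinates. -/
def num (g : Matrix.SpecialLinearGroup (Fin 2) ℚ) (u v : ℂ) : ℂ := g.1 0 0 * u + g.1 0 1 * v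

/-- The denominator of the fractional linear action of a matrix in homogeneous coordinates. -/
def den (g : Matrix.SpecialLinearGroup (Fin 2) ℚ) (u v : ℂ) : ℂ := g.1 1 0 * u + g.1 1 1 * v

theorem num_mul (g h : Matrix.SpecialLinearGroup (Fin 2) ℚ) (u v : ℂ) :
    num (g * h) u v = num g (num h u v) (den h u v) := by
  simp [num, den, Matrix.mul_apply, Fin.sum_univ_two]; ring

theorem den_mul (g h : Matrix.SpecialLinearGroup (Fin 2) ℚ) (u v : ℂ) :
    den (g * h) u v = den g (num h u v) (den h u v) := by
  simp [num, den, Matrix.mul_apply, Fin.sum_univ_two]; ring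

theorem num_smul (g : Matrix.SpecialLinearGroup (Fin 2) ℚ) (c u v : ℂ) :
    num g (c * u) (c * v) = c * num g u v := by
  simp [num]; ring

theorem den_smul (g : Matrix.SpecialLinearGroup (Fin 2) ℚ) (c u v : ℂ) :
    den g (c * u) (c * v) = c * den g u v := by
  simp [den]; ring

/-- A rational matrix of determinant one with integral entries. -/
def IsIntegralMat (g : Matrix.SpecialLinearGroup (Fin 2) ℚ) : Prop :=
  ∃ γ : Matrix.SpecialLinearGroup (Fin 2) ℤ, ∀ i j, g.1 i j = γ.1 i j

theorem IsIntegralMat.mul {g h : Matrix.SpecialLinearGroup (Fin 2) ℚ} (hg : IsIntegralMat g)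
    (hh : IsIntegralMat h) : IsIntegralMat (g * h) := by
  obtain ⟨γ, hγ⟩ := hg
  obtain ⟨δ, hδ⟩ := hh
  refine ⟨γ * δ, fun i j => ?_⟩
  simp [Matrix.SpecialLinearGroup.coe_mul, Matrix.mul_apply, Fin.sum_univ_two, hγ, hδ]

theorem isIntegralMat_one : IsIntegralMat 1 := by
  refine ⟨1, fun i j => ?_⟩
  fin_cases i <;> fin_cases j <;> simp

theorem isIntegralMat_transMat (b : ℤ) : IsIntegralMat (transMat b) := by
  refine ⟨⟨!![1, -b; 0, 1], by simp [Matrix.det_fin_two]⟩, fun i j => ?_⟩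
  fin_cases i <;> fin_cases j <;> simp [transMat]

theorem isIntegralMat_stepMat (b : ℤ) : IsIntegralMat (stepMat b) := by
  refine ⟨⟨!![0, -1; 1, -b], by simp [Matrix.det_fin_two]⟩, fun i j => ?_⟩
  fin_cases i <;> fin_cases j <;> simp [stepMat]

theorem isIntegralMat_infStepMat (z : ℂ) : IsIntegralMat (infStepMat z) := by
  unfold infStepMat
  split_ifs
  · simpa using isIntegralMat_transMat 1
  · exact isIntegralMat_stepMat _

theorem isIntegralMat_infMat (z : ℂ) (j : ℕ) : IsIntegralMat (infMat z j) := by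
  induction j with
  | zero => exact isIntegralMat_one
  | succ j ih => exact (isIntegralMat_infStepMat _).mul ih

theorem infStepMat_action {z : ℂ} (hz : 0 < z.im) :
    den (infStepMat z) z 1 ≠ 0 ∧ num (infStepMat z) z 1 = den (infStepMat z) z 1 * infNext z := by
  unfold infStepMat infNext
  split_ifs
  · simp [num, den, transMat, sub_eq_add_neg]
  · have h : z - nearest z ≠ 0 := by
      intro h
      have := congrArg Complex.im h
      simp [hz.ne'] at this
    have h2 : den (stepMat (nearest z)) z 1 = z - nearest z := by
      simp [den, stepMat, sub_eq_add_neg]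
    rw [h2]
    refine ⟨h, ?_⟩
    rw [mul_div_cancel₀ _ h]
    simp [num, stepMat]

theorem iterate_infNext_im_pos {z : ℂ} (hz : 0 < z.im) (j : ℕ) : 0 < (infNext^[j] z).im := by
  induction j with
  | zero => exact hz
  | succ j ih => rw [Function.iterate_succ_apply']; exact infNext_im_pos ih

theorem infMat_action {z : ℂ} (hz : 0 < z.im) (j : ℕ) :
    den (infMat z j) z 1 ≠ 0 ∧ num (infMat z j) z 1 = den (infMat z j) z 1 * infNext^[j] z := by
  induction j with
  | zero => simp [num, den, infMat]
  | succ j ih =>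
    obtain ⟨h1, h2⟩ := ih
    obtain ⟨h3, h4⟩ := infStepMat_action (iterate_infNext_im_pos hz j)
    rw [infMat, num_mul, den_mul, h2, Function.iterate_succ_apply']
    have e : den (infMat z j) z 1 = den (infMat z j) z 1 * 1 := (mul_one _).symm
    generalize den (infMat z j) z 1 = c at *
    constructor
    · rw [e, mul_assoc, one_mul, den_smul]; exact mul_ne_zero h1 h3
    · conv_lhs => rw [e, mul_assoc, one_mul, num_smul, h4]
      conv_rhs => rw [e, mul_assoc, one_mul, den_smul]
      ring

/-- The `∞`-adic reduction terminates. -/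
theorem exists_iterate_infNext_mem {z : ℂ} (hz : 0 < z.im) :
    ∃ j, infNext^[j] z ∈ fundDomain := by
  by_contra! hnot
  have hstep : ∀ j, (infNext^[j] z).im < (infNext^[j + 1] z).im := by
    intro j
    have hpos := iterate_infNext_im_pos hz j
    have hj1 := hnot (j + 1)
    have hjn : ∀ i, infNext^[i] (infNext^[j + 1] z) ∉ fundDomain := fun i => by
      rw [← Function.iterate_add_apply]; exact hnot _
    rw [Function.iterate_succ_apply'] at hj1 hjn ⊢
    generalize infNext^[j] z = y at *
    by_cases hy : y = Complex.exp (Real.pi / 3 * Complex.I)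
    · exfalso
      apply hj1
      have h := (eq_exp_iff hpos).1 hy
      rw [infNext, if_pos hy, mem_fundDomain_iff]
      simp only [Complex.sub_re, Complex.sub_im, Complex.one_re, Complex.one_im, sub_zero]
      exact ⟨hpos, by linarith [h.1], Or.inr ⟨by linarith [h.1, h.2], by linarith [h.1]⟩⟩
    · rw [infNext, if_neg hy] at hjn ⊢
      have hw : 0 < (y - nearest y).im := by simpa using hpos
      have hlt : (y - nearest y).re ^ 2 + (y - nearest y).im ^ 2 < 1 := by
        by_contra! h
        obtain ⟨i, hi⟩ := exists_infNext_mem_of_one_le hw (sub_nearest_re y).1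
          (sub_nearest_re y).2 h
        exact hjn i hi
      rw [neg_one_div_im, lt_div_iff₀ (re_sq_add_im_sq_pos hw)]
      have : (y - nearest y).im = y.im := by simp
      rw [this] at hlt ⊢
      exact mul_lt_of_lt_one_right hpos hlt
  have hmono : StrictMono fun j => (infNext^[j] z).im := strictMono_nat_of_lt_succ hstep
  choose γ hγ using isIntegralMat_infMat z
  have hden : ∀ j, den (infMat z j) z 1 = ((γ j).1 1 0 : ℂ) * z + ((γ j).1 1 1 : ℂ) := by
    intro j; simp [den, hγ j]
  have hnum : ∀ j, num (infMat z j) z 1 = ((γ j).1 0 0 : ℂ) * z + ((γ j).1 0 1 : ℂ) := by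
    intro j; simp [num, hγ j]
  have him : ∀ j, (infNext^[j] z).im * Complex.normSq (den (infMat z j) z 1) = z.im := by
    intro j
    have h := (infMat_action hz j).2
    rw [hnum] at h
    rw [im_eq_of_mul_eq (hden j) h.symm]
    have hdet := (γ j).2
    rw [Matrix.det_fin_two] at hdet
    have hdet' : (γ j).1 0 0 * (γ j).1 1 1 - (γ j).1 0 1 * (γ j).1 1 0 = 1 := hdet
    have : (((γ j).1 0 0 * (γ j).1 1 1 - (γ j).1 1 0 * (γ j).1 0 1 : ℤ) : ℝ) = 1 := by
      have h5 : (γ j).1 0 0 * (γ j).1 1 1 - (γ j).1 1 0 * (γ j).1 0 1 = 1 := by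
        linear_combination hdet'
      exact_mod_cast h5
    rw [this, one_mul]
  have hinj : Function.Injective fun j => ((γ j).1 1 0, (γ j).1 1 1) := by
    intro i j hij
    apply hmono.injective
    have h1 : den (infMat z i) z 1 = den (infMat z j) z 1 := by
      rw [hden, hden]
      rw [Prod.mk.injEq] at hij
      rw [hij.1, hij.2]
    have h2 := him i
    rw [h1, ← him j] at h2
    exact mul_right_cancel₀ (Complex.normSq_pos.2 (infMat_action hz j).1).ne' h2
  refine Set.infinite_range_of_injective hinj ((finite_setOf_norm_le hz 1).subset ?_)
  rintro _ ⟨j, rfl⟩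
  simp only [Set.mem_ofPred_eq]
  rw [← hden, ← sq_le_one_iff₀ (norm_nonneg _), Complex.sq_norm]
  have h1 : z.im ≤ (infNext^[j] z).im := hmono.monotone (Nat.zero_le j)
  have h2 := him j
  by_contra! h
  have := mul_lt_mul_of_pos_left h (lt_of_lt_of_le hz h1)
  linarith

theorem iterate_infSteps_mem {z : ℂ} (hz : 0 < z.im) : infNext^[infSteps z] z ∈ fundDomain :=
  Nat.sInf_mem (exists_iterate_infNext_mem hz)

end InftyP

namespace InftyP

open scoped ComplexConjugate

/-! ### Powers of a split prime in an imaginary quadratic order -/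

/-- `z` is an integral combination of `1` and `θ`. -/
def IsInt (θ z : ℂ) : Prop := ∃ m n : ℤ, z = m + n * θ

section Order

variable {p : ℕ} [Fact p.Prime] (ι : ℂ ≃+* PadicAlgCl p)

/-- `θ` is a point of the fundamental domain that is a root of `X² + e X + q`, and `p` splits in the
order generated by `θ`. -/
structure SplitRoot (θ : ℂ) (e q : ℤ) : Prop where
  root : θ ^ 2 + e * θ + q = 0
  mem : θ ∈ fundDomain
  padic : θ ∈ padicRing ι
  disc : ¬ (p : ℤ) ∣ e ^ 2 - 4 * q

/-- The elements of `ℤ + ℤ θ` that are divisible by `p ^ (2 k)` in `ℤ_p`. -/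
def primePow (θ : ℂ) (k : ℕ) : Set ℂ := {z | IsInt θ z ∧ z / (p : ℂ) ^ (2 * k) ∈ padicRing ι}

/-- The set `primePow ι θ k` is the multiple `c (ℤ + ℤ θ)` of the order. -/
def GeneratedBy (θ : ℂ) (k : ℕ) (c : ℂ) : Prop :=
  ∀ w, w ∈ primePow ι θ k ↔ ∃ z, IsInt θ z ∧ w = c * z

variable {ι}
variable {θ : ℂ} {e q : ℤ}

theorem isInt_intCast (m : ℤ) : IsInt θ m := ⟨m, 0, by simp⟩

theorem mem_primePow {k : ℕ} {z : ℂ} :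
    z ∈ primePow ι θ k ↔ IsInt θ z ∧ z / (p : ℂ) ^ (2 * k) ∈ padicRing ι := Iff.rfl

theorem GeneratedBy.self_mem {k : ℕ} {c : ℂ} (h : GeneratedBy ι θ k c) : c ∈ primePow ι θ k :=
  (h c).2 ⟨1, by simpa using isInt_intCast (θ := θ) 1, by simp⟩

theorem GeneratedBy.mul_mem {k : ℕ} {c z : ℂ} (h : GeneratedBy ι θ k c) (hz : IsInt θ z) :
    c * z ∈ primePow ι θ k := (h _).2 ⟨z, hz, rfl⟩

theorem p_pow_mem_primePow (k : ℕ) : (p : ℂ) ^ (2 * k) ∈ primePow ι θ k := by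
  refine ⟨by simpa using isInt_intCast (θ := θ) ((p : ℤ) ^ (2 * k)), ?_⟩
  rw [div_self (pow_ne_zero _ natCast_p_ne_zero)]
  exact one_mem _

theorem natCast_p_pow_mem (k : ℕ) : (p : ℂ) ^ k ∈ padicRing ι := pow_mem (natCast_mem _ _) _

theorem GeneratedBy.ne_zero {k : ℕ} {c : ℂ} (h : GeneratedBy ι θ k c) : c ≠ 0 := by
  rintro rfl
  obtain ⟨z, -, hz⟩ := (h _).1 (p_pow_mem_primePow k)
  rw [zero_mul] at hz
  exact pow_ne_zero _ natCast_p_ne_zero hz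

namespace SplitRoot

theorem im_pos (h : SplitRoot ι θ e q) : 0 < θ.im := (mem_fundDomain_iff.1 h.mem).1

theorem conj_eq (h : SplitRoot ι θ e q) : conj θ = -e - θ := by
  have h1 := congrArg conj h.root
  simp only [map_add, map_pow, map_mul, map_intCast, map_zero] at h1
  have h2 : (conj θ - θ) * (conj θ + θ + e) = 0 := by linear_combination h1 - h.root
  rcases mul_eq_zero.1 h2 with h3 | h3
  · have := congrArg Complex.im h3
    simp at this
    linarith [h.im_pos]
  · linear_combination h3

theorem int_mul (h : SplitRoot ι θ e q) {z w : ℂ} (hz : IsInt θ z) (hw : IsInt θ w) :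
    IsInt θ (z * w) := by
  obtain ⟨a, b, rfl⟩ := hz
  obtain ⟨c, d, rfl⟩ := hw
  refine ⟨a * c - b * d * q, a * d + b * c - b * d * e, ?_⟩
  push_cast
  linear_combination (b : ℂ) * d * h.root

theorem int_pow (h : SplitRoot ι θ e q) {z : ℂ} (hz : IsInt θ z) (r : ℕ) : IsInt θ (z ^ r) := by
  induction r with
  | zero => simpa using isInt_intCast (θ := θ) 1
  | succ r ih => rw [pow_succ]; exact h.int_mul ih hz

theorem int_conj (h : SplitRoot ι θ e q) {z : ℂ} (hz : IsInt θ z) : IsInt θ (conj z) := by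
  obtain ⟨a, b, rfl⟩ := hz
  refine ⟨a - b * e, -b, ?_⟩
  simp [h.conj_eq]; ring

theorem mem_ring (h : SplitRoot ι θ e q) {z : ℂ} (hz : IsInt θ z) : z ∈ padicRing ι := by
  obtain ⟨a, b, rfl⟩ := hz
  exact add_mem (intCast_mem _ _) (mul_mem (intCast_mem _ _) h.padic)

theorem norm_eq (h : SplitRoot ι θ e q) (x y : ℤ) :
    (x + y * θ) * conj (x + y * θ) = ((x ^ 2 - e * x * y + q * y ^ 2 : ℤ) : ℂ) := by
  simp only [map_add, map_mul, map_intCast, h.conj_eq]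
  push_cast
  linear_combination -(y : ℂ) ^ 2 * h.root

theorem trace_int (h : SplitRoot ι θ e q) {z : ℂ} (hz : IsInt θ z) : ∃ t : ℤ, z + conj z = t := by
  obtain ⟨a, b, rfl⟩ := hz
  refine ⟨2 * a - b * e, ?_⟩
  simp [h.conj_eq]; ring

theorem rat_unique (h : SplitRoot ι θ e q) {a b a' b' : ℚ}
    (hab : (a : ℂ) + b * θ = a' + b' * θ) : a = a' ∧ b = b' := by
  have h1 := congrArg Complex.im hab
  have h2 := congrArg Complex.re hab
  simp only [Complex.add_im, Complex.mul_im, Complex.ratCast_im, Complex.ratCast_re, zero_mul,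
    add_zero, zero_add] at h1
  have h3 : b = b' := by exact_mod_cast mul_right_cancel₀ h.im_pos.ne' h1
  subst h3
  simp at h2
  exact ⟨h2, rfl⟩

theorem diff_inv_mem (h : SplitRoot ι θ e q) : (conj θ - θ)⁻¹ ∈ padicRing ι := by
  have hd : conj θ - θ ∈ padicRing ι := by
    rw [h.conj_eq]
    exact sub_mem (sub_mem (neg_mem (intCast_mem _ _)) h.padic) h.padic
  refine inv_mem_padicRing_of_not_div_mem hd fun h' => h.disc ?_
  have h1 := mul_mem h' hd
  have h2 : (conj θ - θ) / p * (conj θ - θ) = ((e ^ 2 - 4 * q : ℤ) : ℂ) / (p : ℂ) ^ 1 := by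
    rw [h.conj_eq]
    push_cast
    linear_combination 4 / (p : ℂ) * h.root
  rw [h2, intCast_div_pow_mem_iff, pow_one] at h1
  exact h1

/-- An element of the order is divisible by `p ^ k` if it is so at both primes above `p`. -/
theorem exists_eq_pow_mul (h : SplitRoot ι θ e q) {z : ℂ} (hz : IsInt θ z) {k : ℕ}
    (h1 : z / (p : ℂ) ^ k ∈ padicRing ι) (h2 : conj z / (p : ℂ) ^ k ∈ padicRing ι) :
    ∃ m n : ℤ, z = (((p : ℤ) ^ k * m : ℤ) : ℂ) + (((p : ℤ) ^ k * n : ℤ) : ℂ) * θ := by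
  obtain ⟨a, b, rfl⟩ := hz
  have hp : (p : ℂ) ^ k ≠ 0 := pow_ne_zero _ natCast_p_ne_zero
  have hδ : conj θ - θ ≠ 0 := by
    intro h0
    have := congrArg Complex.im h0
    simp at this
    linarith [h.im_pos]
  have hb : (b : ℂ) / (p : ℂ) ^ k ∈ padicRing ι := by
    have h3 := mul_mem (sub_mem h2 h1) h.diff_inv_mem
    convert h3 using 1
    simp only [map_add, map_mul, map_intCast]
    field_simp
    ring
  have ha : (a : ℂ) / (p : ℂ) ^ k ∈ padicRing ι := by
    have h3 := sub_mem h1 (mul_mem hb h.padic)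
    convert h3 using 1
    field_simp
    ring
  obtain ⟨m, rfl⟩ := intCast_div_pow_mem_iff.1 ha
  obtain ⟨n, rfl⟩ := intCast_div_pow_mem_iff.1 hb
  exact ⟨m, n, rfl⟩

theorem exists_int_eq_pow_mul (h : SplitRoot ι θ e q) {z : ℂ} (hz : IsInt θ z) {k : ℕ}
    (h1 : z / (p : ℂ) ^ k ∈ padicRing ι) (h2 : conj z / (p : ℂ) ^ k ∈ padicRing ι) :
    ∃ w, IsInt θ w ∧ z = (p : ℂ) ^ k * w := by
  obtain ⟨m, n, hmn⟩ := h.exists_eq_pow_mul hz h1 h2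
  exact ⟨m + n * θ, ⟨m, n, rfl⟩, by rw [hmn]; push_cast; ring⟩

theorem exists_mem_primePow_conj_unit (h : SplitRoot ι θ e q) (n : ℕ) :
    ∃ τ ∈ primePow ι θ n, τ ≠ 0 ∧ (conj τ)⁻¹ ∈ padicRing ι := by
  have hp : (p : ℂ) ≠ 0 := natCast_p_ne_zero
  obtain ⟨a, -, ha⟩ := exists_natCast_sub_div_pow_mem h.padic (2 * n + 1)
  have hτ : IsInt θ (θ - a) := ⟨-a, 1, by push_cast; ring⟩
  have h1 : (θ - a) / p ∈ padicRing ι := by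
    convert mul_mem ha (natCast_p_pow_mem (2 * n)) using 1
    rw [pow_succ]
    field_simp
  refine ⟨θ - a, ⟨hτ, ?_⟩, ?_, ?_⟩
  · convert mul_mem ha (natCast_mem (padicRing ι) p) using 1
    field_simp
    ring
  · intro h0
    have := congrArg Complex.im h0
    simp at this
    linarith [h.im_pos]
  · refine inv_mem_padicRing_of_not_div_mem (h.mem_ring (h.int_conj hτ)) fun h2 => ?_
    have h3 := sub_mem h2 h1
    have h4 : conj (θ - a) / p - (θ - a) / p = (conj θ - θ) / p := by
      simp; ring
    rw [h4] at h3
    refine not_div_mem_of_inv_mem_padicRing ?_ h.diff_inv_mem h3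
    intro h0
    have := congrArg Complex.im h0
    simp at this
    linarith [h.im_pos]

theorem exists_int_of_mul_eq (h : SplitRoot ι θ e q) {n : ℕ} {ε τ η : ℂ}
    (hε : ε ∈ primePow ι θ n) (hτ : (conj τ)⁻¹ ∈ padicRing ι) (hτ0 : τ ≠ 0) (hη : IsInt θ η)
    (heq : ε * τ = (p : ℂ) ^ (2 * n) * η) : ∃ w, IsInt θ w ∧ ε = (p : ℂ) ^ (2 * n) * w := by
  have hp : (p : ℂ) ≠ 0 := natCast_p_ne_zero
  refine h.exists_int_eq_pow_mul hε.1 hε.2 ?_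
  have h1 := mul_mem (h.mem_ring (h.int_conj hη)) hτ
  convert h1 using 1
  have hτ0' : conj τ ≠ 0 := by simpa using hτ0
  have h2 := congrArg conj heq
  simp only [map_mul, map_pow, map_natCast] at h2
  field_simp
  linear_combination h2

theorem primePow_mono {m n : ℕ} (hmn : m ≤ n) {z : ℂ} (hz : z ∈ primePow ι θ n) :
    z ∈ primePow ι θ m := by
  refine ⟨hz.1, ?_⟩
  obtain ⟨k, rfl⟩ := Nat.exists_eq_add_of_le hmn
  have hp : (p : ℂ) ≠ 0 := natCast_p_ne_zero
  convert mul_mem hz.2 (natCast_p_pow_mem (2 * k)) using 1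
  rw [mul_add, pow_add]
  field_simp

theorem mul_mem_primePow (h : SplitRoot ι θ e q) {m n : ℕ} {z w : ℂ} (hz : z ∈ primePow ι θ m)
    (hw : w ∈ primePow ι θ n) : z * w ∈ primePow ι θ (m + n) := by
  refine ⟨h.int_mul hz.1 hw.1, ?_⟩
  convert mul_mem hz.2 hw.2 using 1
  rw [mul_add, pow_add, mul_div_mul_comm]

/-- Homothetic powers of the prime differ by a principal power. -/
theorem generatedBy_of_homothetic (h : SplitRoot ι θ e q) {n k : ℕ} {γ : ℂ} (hγ0 : γ ≠ 0)
    (hγ : ∀ w, w ∈ primePow ι θ n ↔ γ * w ∈ primePow ι θ (n + k)) : GeneratedBy ι θ k γ := by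
  have hp : (p : ℂ) ≠ 0 := natCast_p_ne_zero
  have hpn : (p : ℂ) ^ (2 * n) ≠ 0 := pow_ne_zero _ hp
  obtain ⟨τ, hτ, hτ0, hτu⟩ := h.exists_mem_primePow_conj_unit n
  have hmem := (hγ _).1 (p_pow_mem_primePow n)
  have hint : IsInt θ γ := by
    obtain ⟨w, hw, hw'⟩ := h.exists_int_of_mul_eq (primePow_mono (Nat.le_add_right n k) hmem) hτu
      hτ0 ((hγ _).1 hτ).1 (by ring)
    have : γ = w := mul_right_cancel₀ hpn (by rw [hw', mul_comm])
    rwa [this]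
  have hk : γ / (p : ℂ) ^ (2 * k) ∈ padicRing ι := by
    convert hmem.2 using 1
    rw [mul_add, pow_add]
    field_simp
  intro β
  constructor
  · intro hβ
    have h1 : (p : ℂ) ^ (2 * n) * β / γ ∈ primePow ι θ n := by
      rw [hγ, mul_div_cancel₀ _ hγ0]
      exact h.mul_mem_primePow (p_pow_mem_primePow n) hβ
    have h2 : τ * β / γ ∈ primePow ι θ n := by
      rw [hγ, mul_div_cancel₀ _ hγ0]
      exact h.mul_mem_primePow hτ hβ
    obtain ⟨w, hw, hw'⟩ := h.exists_int_of_mul_eq h1 hτu hτ0 h2.1 (by ring)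
    refine ⟨w, hw, ?_⟩
    rw [mul_div_assoc] at hw'
    rw [← mul_left_cancel₀ hpn hw', mul_div_cancel₀ _ hγ0]
  · rintro ⟨z, hz, rfl⟩
    refine ⟨h.int_mul hint hz, ?_⟩
    rw [mul_div_right_comm]
    exact mul_mem hk (h.mem_ring hz)

theorem generatedBy_zero (h : SplitRoot ι θ e q) : GeneratedBy ι θ 0 1 := by
  intro w
  simp only [mem_primePow, mul_zero, pow_zero, div_one, one_mul, exists_eq_right']
  exact ⟨fun h' => h'.1, fun h' => ⟨h', h.mem_ring h'⟩⟩

theorem inv_mem_of_generatedBy (h : SplitRoot ι θ e q) {n : ℕ} {c : ℂ}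
    (hc : GeneratedBy ι θ n c) : (c / (p : ℂ) ^ (2 * n))⁻¹ ∈ padicRing ι := by
  obtain ⟨z, hz, hz'⟩ := (hc _).1 (p_pow_mem_primePow n)
  have := hc.ne_zero
  rw [inv_div, hz', mul_div_cancel_left₀ _ this]
  exact h.mem_ring hz

theorem mul_mem_primePow_iff (h : SplitRoot ι θ e q) {n m : ℕ} {c w : ℂ}
    (hc : GeneratedBy ι θ n c) : c * w ∈ primePow ι θ (n + m) ↔ w ∈ primePow ι θ m := by
  constructor
  · intro hw
    obtain ⟨z, hz, hz'⟩ := (hc _).1 (primePow_mono (Nat.le_add_right n m) hw)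
    have hwz := mul_left_cancel₀ hc.ne_zero hz'
    refine ⟨hwz ▸ hz, ?_⟩
    convert mul_mem hw.2 (h.inv_mem_of_generatedBy hc) using 1
    have h1 := hc.ne_zero
    have h2 := natCast_p_ne_zero (p := p)
    rw [mul_add, pow_add]
    field_simp
  · exact fun hw => h.mul_mem_primePow hc.self_mem hw

theorem generatedBy_mul (h : SplitRoot ι θ e q) {n m : ℕ} {c c' : ℂ}
    (hc : GeneratedBy ι θ n c) (hc' : GeneratedBy ι θ m c') :
    GeneratedBy ι θ (n + m) (c * c') := by
  intro w
  constructor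
  · intro hw
    obtain ⟨z, -, rfl⟩ := (hc _).1 (primePow_mono (Nat.le_add_right n m) hw)
    obtain ⟨y, hy, rfl⟩ := (hc' _).1 ((h.mul_mem_primePow_iff hc).1 hw)
    exact ⟨y, hy, by ring⟩
  · rintro ⟨z, hz, rfl⟩
    rw [mul_assoc, h.mul_mem_primePow_iff hc]
    exact hc'.mul_mem hz

theorem generatedBy_pow (h : SplitRoot ι θ e q) {n : ℕ} {c : ℂ}
    (hc : GeneratedBy ι θ n c) (r : ℕ) : GeneratedBy ι θ (r * n) (c ^ r) := by
  induction r with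
  | zero => simpa using h.generatedBy_zero
  | succ r ih => rw [pow_succ, Nat.succ_mul]; exact h.generatedBy_mul ih hc

theorem exists_generatedBy_sub (h : SplitRoot ι θ e q) {n m : ℕ} {c c' : ℂ}
    (hc : GeneratedBy ι θ n c) (hc' : GeneratedBy ι θ (n + m) c') :
    ∃ c'', GeneratedBy ι θ m c'' := by
  obtain ⟨z, hz, rfl⟩ := (hc _).1 (primePow_mono (Nat.le_add_right n m) hc'.self_mem)
  refine ⟨z, fun w => ?_⟩
  rw [← h.mul_mem_primePow_iff hc, hc' (c * w)]
  refine exists_congr fun y => and_congr_right fun _ => ?_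
  rw [mul_assoc]
  exact mul_right_inj' hc.ne_zero

/-- An element of norm `p ^ (2 k)` that is a unit at the conjugate prime generates the power of
the prime. -/
theorem generatedBy_of_norm (h : SplitRoot ι θ e q) {k : ℕ} {β : ℂ} (hβ : IsInt θ β)
    (hnorm : β * conj β = (p : ℂ) ^ (2 * k)) (hu : (conj β)⁻¹ ∈ padicRing ι) :
    GeneratedBy ι θ k β := by
  have hpk : (p : ℂ) ^ (2 * k) ≠ 0 := pow_ne_zero _ natCast_p_ne_zero
  have hβ0 : β ≠ 0 := by rintro rfl; simp at hnorm; exact hpk (by simpa using hnorm.symm)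
  have hβ0' : conj β ≠ 0 := by simpa using hβ0
  have hβk : β / (p : ℂ) ^ (2 * k) ∈ padicRing ι := by
    convert hu using 1
    rw [← hnorm]; field_simp
  intro w
  constructor
  · intro hw
    obtain ⟨z, hz, hz'⟩ := h.exists_int_eq_pow_mul (k := 2 * k)
      (h.int_mul hw.1 (h.int_conj hβ))
      (by
        rw [mul_div_right_comm]
        exact mul_mem hw.2 (h.mem_ring (h.int_conj hβ)))
      (by
        rw [map_mul, Complex.conj_conj, mul_div_assoc]
        exact mul_mem (h.mem_ring (h.int_conj hw.1)) hβk)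
    refine ⟨z, hz, ?_⟩
    rw [← hnorm] at hz'
    exact mul_right_cancel₀ hβ0' (by rw [hz']; ring)
  · rintro ⟨z, hz, rfl⟩
    refine ⟨h.int_mul hβ hz, ?_⟩
    rw [mul_div_right_comm]
    exact mul_mem hβk (h.mem_ring hz)

/-- An element of the order of absolute value one is a root of unity. -/
theorem exists_pow_eq_one (h : SplitRoot ι θ e q) {ζ : ℂ} (hζ : IsInt θ ζ) (h1 : ‖ζ‖ = 1) :
    ∃ n : ℕ, 0 < n ∧ ζ ^ n = 1 := by
  choose a b hab using fun n : ℕ => h.int_pow hζ n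
  have hfin := finite_setOf_norm_le h.im_pos 1
  have hnot : ¬ Function.Injective fun n => (b n, a n) := by
    intro hinj
    refine Set.infinite_range_of_injective hinj (hfin.subset ?_)
    rintro _ ⟨n, rfl⟩
    simp only [Set.mem_ofPred_eq]
    rw [add_comm, ← hab n, norm_pow, h1, one_pow]
  obtain ⟨i, j, hij, hne⟩ := Function.not_injective_iff.1 hnot
  rw [Prod.mk.injEq] at hij
  have heq : ζ ^ i = ζ ^ j := by rw [hab i, hab j, hij.1, hij.2]
  have hζ0 : ζ ≠ 0 := by rintro rfl; simp at h1
  wlog hlt : i < j generalizing i j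
  · exact this j i ⟨hij.1.symm, hij.2.symm⟩ hne.symm heq.symm
      (lt_of_le_of_ne (not_lt.1 hlt) hne.symm)
  refine ⟨j - i, by omega, ?_⟩
  refine mul_left_cancel₀ (pow_ne_zero i hζ0) ?_
  rw [← pow_add, mul_one, heq]
  congr 1; omega

/-- Generators of the same power of the prime differ by a root of unity. -/
theorem eq_root_of_unity_mul (h : SplitRoot ι θ e q) {k : ℕ} {β c : ℂ}
    (hβ : GeneratedBy ι θ k β) (hc : GeneratedBy ι θ k c)
    (hnorm : ‖β‖ = ‖c‖) : ∃ ζ, IsInt θ ζ ∧ (∃ n : ℕ, 0 < n ∧ ζ ^ n = 1) ∧ β = ζ * c := by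
  obtain ⟨ζ, hζ, rfl⟩ := (hc β).1 hβ.self_mem
  refine ⟨ζ, hζ, h.exists_pow_eq_one hζ ?_, mul_comm _ _⟩
  rw [norm_mul] at hnorm
  exact mul_left_cancel₀ (norm_ne_zero_iff.2 hc.ne_zero) (by rw [hnorm, mul_one])

/-- Primitive elements of norm `p ^ (2 k)` generate the power of the prime, up to conjugation. -/
theorem generatedBy_or_conj_of_primitive (h : SplitRoot ι θ e q) {x y : ℤ} (hxy : IsCoprime x y)
    {k : ℕ} (hnorm : x ^ 2 - e * x * y + q * y ^ 2 = (p : ℤ) ^ (2 * k)) :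
    GeneratedBy ι θ k (x + y * θ) ∨ GeneratedBy ι θ k (conj (x + y * θ)) := by
  have hβ : IsInt θ (x + y * θ) := ⟨x, y, rfl⟩
  have hn : (x + y * θ) * conj (x + y * θ) = (p : ℂ) ^ (2 * k) := by
    rw [h.norm_eq, hnorm]; push_cast; rfl
  rcases div_mem_or_inv_mem_padicRing (h.mem_ring (h.int_conj hβ)) with h1 | h1
  · rcases div_mem_or_inv_mem_padicRing (h.mem_ring hβ) with h2 | h2
    · exfalso
      obtain ⟨m, n, hmn⟩ := h.exists_eq_pow_mul (k := 1) hβ (by simpa using h2) (by simpa using h1)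
      have h3 := h.rat_unique (a := x) (b := y) (a' := ((p : ℤ) ^ 1 * m : ℤ))
        (b' := ((p : ℤ) ^ 1 * n : ℤ)) (by simpa using hmn)
      have hx : x = (p : ℤ) ^ 1 * m := by exact_mod_cast h3.1
      have hy : y = (p : ℤ) ^ 1 * n := by exact_mod_cast h3.2
      rw [pow_one] at hx hy
      exact (Nat.prime_iff_prime_int.1 (Fact.out : p.Prime)).not_isUnit
        (hxy.isUnit_of_dvd' ⟨m, hx⟩ ⟨n, hy⟩)
    · right
      refine h.generatedBy_of_norm (h.int_conj hβ) ?_ ?_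
      · rw [Complex.conj_conj, mul_comm, hn]
      · rwa [Complex.conj_conj]
  · exact Or.inl (h.generatedBy_of_norm hβ hn h1)

theorem mul_pow_div_notMem {l r : ℕ} {ζ α : ℂ} (hl : 0 < l) (hζ : ζ ^ l = 1)
    (hu : α⁻¹ ∈ padicRing ι) (hα0 : α ≠ 0) (hmem : ζ * α ^ r ∈ padicRing ι) :
    ζ * α ^ r / p ∉ padicRing ι := by
  intro hdiv
  obtain ⟨i, rfl⟩ : ∃ i, l = i + 1 := ⟨l - 1, by omega⟩
  refine not_div_mem_of_inv_mem_padicRing (ι := ι) (pow_ne_zero (r * (i + 1)) hα0)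
    (by rw [← inv_pow]; exact pow_mem hu _) ?_
  convert mul_mem hdiv (pow_mem hmem i) using 1
  rw [div_mul_eq_mul_div, ← pow_succ', mul_pow, hζ, one_mul, pow_mul]

/-- Multiples of powers of a generator by roots of unity are primitive. -/
theorem isCoprime_of_eq_mul_pow (h : SplitRoot ι θ e q) {N r l : ℕ} {x y : ℤ} {ζ α : ℂ}
    (hl : 0 < l) (hζ : ζ ^ l = 1) (hα0 : α ≠ 0)
    (hu : α⁻¹ ∈ padicRing ι ∨ (conj α)⁻¹ ∈ padicRing ι)
    (hnorm : α * conj α = (p : ℂ) ^ (2 * N)) (heq : x + y * θ = ζ * α ^ r) :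
    IsCoprime x y ∧ x ^ 2 - e * x * y + q * y ^ 2 = (p : ℤ) ^ (2 * (r * N)) := by
  have hp : (p : ℂ) ≠ 0 := natCast_p_ne_zero
  have hζ1 : ζ * conj ζ = 1 := by
    rw [Complex.mul_conj, Complex.normSq_eq_norm_sq,
      Complex.norm_eq_one_of_pow_eq_one hζ hl.ne']
    simp
  have hn : x ^ 2 - e * x * y + q * y ^ 2 = (p : ℤ) ^ (2 * (r * N)) := by
    have h1 := h.norm_eq x y
    rw [heq] at h1
    have h2 : ζ * α ^ r * conj (ζ * α ^ r) = (p : ℂ) ^ (2 * (r * N)) := by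
      rw [map_mul, map_pow, mul_mul_mul_comm, hζ1, one_mul, ← mul_pow, hnorm, ← pow_mul]
      congr 1; ring
    rw [h2] at h1
    exact_mod_cast h1.symm
  refine ⟨?_, hn⟩
  rw [Int.isCoprime_iff_gcd_eq_one]
  by_contra hg
  obtain ⟨l', hl', hdvd⟩ := Nat.exists_prime_and_dvd hg
  have hx : (l' : ℤ) ∣ x := (Int.natCast_dvd_natCast.2 hdvd).trans (Int.gcd_dvd_left ..)
  have hy : (l' : ℤ) ∣ y := (Int.natCast_dvd_natCast.2 hdvd).trans (Int.gcd_dvd_right ..)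
  have hlp : l' = p := by
    have h1 : (l' : ℤ) ∣ (p : ℤ) ^ (2 * (r * N)) := by
      rw [← hn]
      refine dvd_add (dvd_sub (dvd_pow hx two_ne_zero) (Dvd.dvd.mul_left hy _))
        (Dvd.dvd.mul_left (dvd_pow hy two_ne_zero) _)
    have h2 : l' ∣ p ^ (2 * (r * N)) := by exact_mod_cast h1
    exact (Nat.prime_dvd_prime_iff_eq hl' Fact.out).1 (hl'.dvd_of_dvd_pow h2)
  subst hlp
  obtain ⟨m, rfl⟩ := hx
  obtain ⟨n, rfl⟩ := hy
  have hdiv : ζ * α ^ r = l' * (m + n * θ) := by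
    rw [← heq]; push_cast; ring
  have hint : IsInt θ (m + n * θ) := ⟨m, n, rfl⟩
  have hint' : IsInt θ (ζ * α ^ r) := heq ▸ ⟨_, _, rfl⟩
  rcases hu with hu | hu
  · refine mul_pow_div_notMem hl hζ hu hα0 (h.mem_ring hint') ?_
    rw [hdiv, mul_div_cancel_left₀ _ hp]
    exact h.mem_ring hint
  · refine mul_pow_div_notMem (ζ := conj ζ) (r := r) hl (by rw [← map_pow, hζ, map_one]) hu
      (by simpa using hα0) ?_ ?_ <;> rw [← map_pow, ← map_mul]
    · exact h.mem_ring (h.int_conj hint')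
    · rw [hdiv, map_mul, map_natCast, mul_div_cancel_left₀ _ hp]
      exact h.mem_ring (h.int_conj hint)

end SplitRoot
end Order
end InftyP

namespace InftyP

open scoped ComplexConjugate

/-! ### The lattices of the algorithm -/

/-- The set `S` is the lattice `ℤ u + ℤ v`. -/
def IsSpan (S : Set ℂ) (u v : ℂ) : Prop := ∀ w, w ∈ S ↔ ∃ m n : ℤ, w = m * u + n * v

theorem IsSpan.of_isIntegralMat {S : Set ℂ} {u v : ℂ} (h : IsSpan S u v)
    {g : Matrix.SpecialLinearGroup (Fin 2) ℚ} (hg : IsIntegralMat g) :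
    IsSpan S (num g u v) (den g u v) := by
  obtain ⟨γ, hγ⟩ := hg
  have hdet : γ.1 0 0 * γ.1 1 1 - γ.1 0 1 * γ.1 1 0 = 1 := by
    rw [← Matrix.det_fin_two]; exact γ.2
  have hdet' : (γ.1 0 0 : ℂ) * γ.1 1 1 - γ.1 0 1 * γ.1 1 0 = 1 := by exact_mod_cast hdet
  intro w
  rw [h w]
  simp only [num, den, hγ, Rat.cast_intCast]
  constructor
  · rintro ⟨m, n, rfl⟩
    refine ⟨m * γ.1 1 1 - n * γ.1 1 0, n * γ.1 0 0 - m * γ.1 0 1, ?_⟩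
    push_cast
    linear_combination (-(m * u + n * v)) * hdet'
  · rintro ⟨m, n, rfl⟩
    refine ⟨m * γ.1 0 0 + n * γ.1 1 0, m * γ.1 0 1 + n * γ.1 1 1, ?_⟩
    push_cast
    ring

theorem isIntegralMat_invMat : IsIntegralMat invMat := by
  refine ⟨⟨!![0, -1; 1, 0], by simp [Matrix.det_fin_two]⟩, fun i j => ?_⟩
  fin_cases i <;> fin_cases j <;> simp [invMat]

section Algorithm

variable {p : ℕ} [Fact p.Prime] {ι : ℂ ≃+* PadicAlgCl p} {θ : ℂ} {e q : ℤ}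

/-- The initialization makes the denominator a generator at the prime. -/
theorem initial_step {k : ℕ} {u v : ℂ} (hS : IsSpan (primePow ι θ k) u v)
    (hv : v ≠ 0) (him : 0 < (u / v).im) :
    IsIntegralMat (matD ι (u / v)) ∧
    den (matD ι (u / v)) u v ≠ 0 ∧
    num (matD ι (u / v)) u v / den (matD ι (u / v)) u v = initial ι (u / v) ∧
    initial ι (u / v) ∈ padicRing ι ∧ 0 < (initial ι (u / v)).im ∧
    (den (matD ι (u / v)) u v / (p : ℂ) ^ (2 * k)) ∈ padicRing ι ∧
    (den (matD ι (u / v)) u v / (p : ℂ) ^ (2 * k))⁻¹ ∈ padicRing ι := by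
  have hpk : (p : ℂ) ^ (2 * k) ≠ 0 := pow_ne_zero _ natCast_p_ne_zero
  have hu : u ≠ 0 := by rintro rfl; simp at him
  have hU := ((hS u).2 ⟨1, 0, by simp⟩).2
  have hV := ((hS v).2 ⟨0, 1, by simp⟩).2
  obtain ⟨m, n, hmn⟩ := (hS _).1 (p_pow_mem_primePow k)
  unfold matD initial
  by_cases hx : IsPadicInt ι (u / v)
  · rw [if_pos hx, if_pos hx]
    have hd : den 1 u v = v := by simp [den]
    have hn : num 1 u v = u := by simp [num]
    rw [hd, hn]
    refine ⟨isIntegralMat_one, hv, rfl, isPadicInt_iff.1 hx, him, hV, ?_⟩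
    have : (v / (p : ℂ) ^ (2 * k))⁻¹ = m * (u / v) + n := by
      rw [inv_div, hmn]; field_simp
    rw [this]
    exact add_mem (mul_mem (intCast_mem _ _) (isPadicInt_iff.1 hx)) (intCast_mem _ _)
  · rw [if_neg hx, if_neg hx]
    have hd : den invMat u v = u := by simp [den, invMat]
    have hn : num invMat u v = -v := by simp [num, invMat]
    have hvu : v / u ∈ padicRing ι := by
      rcases div_mem_or_div_mem_padicRing hU hV with h | h
      · rw [div_div_div_cancel_right₀ hpk] at h
        exact absurd (isPadicInt_iff.2 h) hx
      · rwa [div_div_div_cancel_right₀ hpk] at h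
    have hinit : -1 / (u / v) = -v / u := by field_simp
    rw [hd, hn, hinit]
    refine ⟨isIntegralMat_invMat, hu, rfl, by rw [neg_div]; exact neg_mem hvu, ?_, hU, ?_⟩
    · rw [← hinit, neg_one_div_im]
      exact div_pos him (re_sq_add_im_sq_pos him)
    · have : (u / (p : ℂ) ^ (2 * k))⁻¹ = m + n * (v / u) := by
        rw [inv_div, hmn]; field_simp
      rw [this]
      exact add_mem (intCast_mem _ _) (mul_mem (intCast_mem _ _) hvu)

/-- The `p`-adic reduction passes from a basis of a power of the prime to a basis of the next. -/
theorem padicRed_step {k : ℕ} {u v : ℂ} (hS : IsSpan (primePow ι θ k) u v) (hv : v ≠ 0)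
    (hz : u / v ∈ padicRing ι) (hV : v / (p : ℂ) ^ (2 * k) ∈ padicRing ι)
    (hV' : (v / (p : ℂ) ^ (2 * k))⁻¹ ∈ padicRing ι) :
    IsSpan (primePow ι θ (k + 1)) (u - digit ι (u / v) * v) ((p : ℂ) ^ 2 * v) := by
  have hp : (p : ℂ) ≠ 0 := natCast_p_ne_zero
  have hd := digit_spec hz
  generalize digit ι (u / v) = a at hd
  have hdiff : (u - a * v) / (p : ℂ) ^ (2 * (k + 1)) ∈ padicRing ι := by
    convert mul_mem hV hd using 1
    rw [mul_add, pow_add]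
    field_simp
  intro w
  constructor
  · intro hw
    obtain ⟨m, n, rfl⟩ := (hS w).1 (SplitRoot.primePow_mono (Nat.le_succ k) hw)
    have h1 : ((n + m * a : ℤ) : ℂ) / (p : ℂ) ^ 2 ∈ padicRing ι := by
      have h2 := mul_mem (sub_mem hw.2 (mul_mem (intCast_mem _ m) hdiff)) hV'
      convert h2 using 1
      rw [mul_add, pow_add]
      push_cast
      field_simp
      ring
    obtain ⟨l, hl⟩ := intCast_div_pow_mem_iff.1 h1
    refine ⟨m, l, ?_⟩
    have hl' : (n : ℂ) + m * a = (p : ℂ) ^ 2 * l := by exact_mod_cast hl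
    linear_combination v * hl'
  · rintro ⟨m, n, rfl⟩
    refine ⟨((hS _).2 ⟨m, n * p ^ 2 - m * a, by push_cast; ring⟩).1, ?_⟩
    rw [add_div]
    refine add_mem ?_ ?_
    · rw [mul_div_assoc]
      exact mul_mem (intCast_mem _ _) hdiff
    · convert mul_mem (intCast_mem (padicRing ι) n) hV using 1
      rw [mul_add, pow_add]
      field_simp

/-- One loop of the algorithm. -/
theorem loop_step {k : ℕ} {u v : ℂ} (hS : IsSpan (primePow ι θ k) u v)
    (hv : v ≠ 0) (him : 0 < (u / v).im) :
    IsSpan (primePow ι θ (k + 1))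
      (p * num (matQ ι (u / v) * matP ι (u / v) * matD ι (u / v)) u v)
      (p * den (matQ ι (u / v) * matP ι (u / v) * matD ι (u / v)) u v) ∧
    den (matQ ι (u / v) * matP ι (u / v) * matD ι (u / v)) u v ≠ 0 ∧
    num (matQ ι (u / v) * matP ι (u / v) * matD ι (u / v)) u v =
      den (matQ ι (u / v) * matP ι (u / v) * matD ι (u / v)) u v * next ι (u / v) ∧
    next ι (u / v) ∈ fundDomain := by
  have hp : (p : ℂ) ≠ 0 := natCast_p_ne_zero
  obtain ⟨hD, hv1, hz, hzR, hzim, hV, hV'⟩ := initial_step hS hv him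
  generalize u / v = x at *
  have hS1 := hS.of_isIntegralMat hD
  rw [num_mul, den_mul, num_mul, den_mul]
  generalize num (matD ι x) u v = u1 at *
  generalize den (matD ι x) u v = v1 at *
  have hS2 := padicRed_step hS1 hv1 (hz ▸ hzR) hV hV'
  rw [hz] at hS2
  have hn : num (matP ι x) u1 v1 = (p : ℂ)⁻¹ * (u1 - digit ι (initial ι x) * v1) := by
    rw [matP, num_mul]
    simp only [num, den, scaleMat, transMat]
    simp
    ring_nf
    simp
  have hd : den (matP ι x) u1 v1 = p * v1 := by
    rw [matP, den_mul]
    simp [num, den, scaleMat, transMat]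
  have hred : u1 - digit ι (initial ι x) * v1 = p ^ 2 * v1 * padicRed ι (initial ι x) := by
    rw [padicRed, ← hz]; field_simp
  have hzim' : 0 < (padicRed ι (initial ι x)).im := by
    have h1 : padicRed ι (initial ι x) =
        (initial ι x - digit ι (initial ι x)) * (((p : ℝ) ^ 2)⁻¹ : ℝ) := by
      rw [padicRed]; push_cast; rw [div_eq_mul_inv]
    rw [h1, Complex.im_mul_ofReal]
    have hpr : (0 : ℝ) < p := by exact_mod_cast (Fact.out : p.Prime).pos
    simp only [Complex.sub_im, Complex.natCast_im, sub_zero]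
    positivity
  have hdom := iterate_infSteps_mem hzim'
  have hS3 := hS2.of_isIntegralMat (isIntegralMat_infMat (padicRed ι (initial ι x))
    (infSteps (padicRed ι (initial ι x))))
  obtain ⟨hden, hact⟩ := infMat_action hzim' (infSteps (padicRed ι (initial ι x)))
  have e1 : num (matP ι x) u1 v1 = (p * v1) * padicRed ι (initial ι x) := by
    rw [hn, hred]; field_simp
  have e2 : den (matP ι x) u1 v1 = (p * v1) * 1 := by rw [hd, mul_one]
  have e3 : (p : ℂ) ^ 2 * v1 = p ^ 2 * v1 * 1 := (mul_one _).symm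
  rw [hred] at hS3
  rw [e3, mul_assoc ((p : ℂ) ^ 2 * v1) 1, one_mul, num_smul, den_smul] at hS3
  rw [e1, e2, num_smul, den_smul]
  change IsSpan _ (p * (p * v1 * num (infMat _ _) _ _)) (p * (p * v1 * den (infMat _ _) _ _)) ∧
    p * v1 * den (infMat _ _) _ _ ≠ 0 ∧
    p * v1 * num (infMat _ _) _ _ = p * v1 * den (infMat _ _) _ _ * infNext^[_] _ ∧ _
  refine ⟨?_, mul_ne_zero (mul_ne_zero hp hv1) hden, ?_, hdom⟩
  · convert hS3 using 1 <;> ring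
  · rw [hact]; ring

namespace SplitRoot

/-- The matrices of the algorithm give bases of the powers of the prime. -/
theorem isSpan_matB (h : SplitRoot ι θ e q) (k : ℕ) :
    IsSpan (primePow ι θ k) ((p : ℂ) ^ k * num (matB ι θ k)⁻¹ θ 1)
      ((p : ℂ) ^ k * den (matB ι θ k)⁻¹ θ 1) ∧
    den (matB ι θ k)⁻¹ θ 1 ≠ 0 ∧
    num (matB ι θ k)⁻¹ θ 1 = den (matB ι θ k)⁻¹ θ 1 * cfX ι θ k ∧ cfX ι θ k ∈ fundDomain := by
  have hp : (p : ℂ) ≠ 0 := natCast_p_ne_zero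
  induction k with
  | zero =>
    have hn : num (matB ι θ 0)⁻¹ θ 1 = θ := by simp [num, matB]
    have hd : den (matB ι θ 0)⁻¹ θ 1 = 1 := by simp [den, matB]
    rw [hn, hd]
    refine ⟨fun w => ?_, one_ne_zero, by simp [cfX], by simpa [cfX] using h.mem⟩
    simp only [mem_primePow, mul_zero, pow_zero, div_one, one_mul, mul_one]
    constructor
    · rintro ⟨⟨m, n, rfl⟩, -⟩
      exact ⟨n, m, by ring⟩
    · rintro ⟨m, n, rfl⟩
      have : IsInt θ (m * θ + n) := ⟨n, m, by ring⟩
      exact ⟨this, h.mem_ring this⟩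
  | succ k ih =>
    obtain ⟨hS, hd, hn, hx⟩ := ih
    have hB : (matB ι θ (k + 1))⁻¹ = matQ ι (cfX ι θ k) * matP ι (cfX ι θ k) *
        matD ι (cfX ι θ k) * (matB ι θ k)⁻¹ := by
      rw [matB, matA, mul_inv_rev, inv_inv]
    have hX : cfX ι θ (k + 1) = next ι (cfX ι θ k) := by
      rw [cfX, Function.iterate_succ_apply', cfX]
    rw [hB, num_mul, den_mul, hX]
    have hv : (p : ℂ) ^ k * den (matB ι θ k)⁻¹ θ 1 ≠ 0 := mul_ne_zero (pow_ne_zero _ hp) hd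
    have hq : (p : ℂ) ^ k * num (matB ι θ k)⁻¹ θ 1 / ((p : ℂ) ^ k * den (matB ι θ k)⁻¹ θ 1) =
        cfX ι θ k := by
      rw [hn]; field_simp
    have hstep := loop_step hS hv (by rw [hq]; exact (mem_fundDomain_iff.1 hx).1)
    rw [hq, num_smul, den_smul] at hstep
    obtain ⟨h1, h2, h3, h4⟩ := hstep
    refine ⟨?_, right_ne_zero_of_mul h2, ?_, h4⟩
    · convert h1 using 1 <;> ring
    · exact mul_left_cancel₀ (pow_ne_zero k hp) (by rw [h3]; ring)

theorem num_mul_conj_den_im (g : Matrix.SpecialLinearGroup (Fin 2) ℚ) (u : ℂ) :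
    (num g u 1 * conj (den g u 1)).im = u.im := by
  have hdet : g.1 0 0 * g.1 1 1 - g.1 0 1 * g.1 1 0 = 1 := by
    rw [← Matrix.det_fin_two]; exact g.2
  have hdet' : (g.1 0 0 : ℝ) * g.1 1 1 - g.1 0 1 * g.1 1 0 = 1 := by exact_mod_cast hdet
  simp [num, den]
  linear_combination u.im * hdet'

/-- The points of the sequence are `x = u / v` for bases `u, v` of the powers of the prime with
covolume `p ^ (2 k) Im θ`. -/
theorem exists_basis (h : SplitRoot ι θ e q) (k : ℕ) :
    ∃ u v : ℂ, IsSpan (primePow ι θ k) u v ∧ v ≠ 0 ∧ u = v * cfX ι θ k ∧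
      v = (p : ℂ) ^ k * den (matB ι θ k)⁻¹ θ 1 ∧
      (cfX ι θ k).im * Complex.normSq v = (p : ℝ) ^ (2 * k) * θ.im := by
  obtain ⟨h1, h2, h3, -⟩ := h.isSpan_matB k
  refine ⟨_, _, h1, mul_ne_zero (pow_ne_zero _ natCast_p_ne_zero) h2, by rw [h3]; ring, rfl, ?_⟩
  have h4 := num_mul_conj_den_im (matB ι θ k)⁻¹ θ
  rw [h3, mul_right_comm, Complex.mul_conj, Complex.im_ofReal_mul] at h4
  rw [← h4, Complex.normSq_mul, map_pow, Complex.normSq_natCast]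
  ring

theorem generatedBy_of_cfX_eq (h : SplitRoot ι θ e q) {k : ℕ} (hk : cfX ι θ k = θ) :
    GeneratedBy ι θ k ((p : ℂ) ^ k * den (matB ι θ k)⁻¹ θ 1) := by
  obtain ⟨u, v, h1, h2, h3, h4, -⟩ := h.exists_basis k
  rw [← h4]
  intro w
  rw [h1 w, h3, hk]
  constructor
  · rintro ⟨m, n, rfl⟩
    exact ⟨n + m * θ, ⟨n, m, rfl⟩, by ring⟩
  · rintro ⟨_, ⟨n, m, rfl⟩, rfl⟩
    exact ⟨m, n, by ring⟩

theorem cfX_eq_of_generatedBy (h : SplitRoot ι θ e q) {k : ℕ} {c : ℂ}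
    (hc : GeneratedBy ι θ k c) : cfX ι θ k = θ := by
  obtain ⟨u, v, h1, h2, h3, -, -⟩ := h.exists_basis k
  have hx := (h.isSpan_matB k).2.2.2
  have hc0 := hc.ne_zero
  have hθ : IsInt θ θ := ⟨0, 1, by simp⟩
  obtain ⟨m, n, hmn⟩ := (h1 _).1 hc.self_mem
  obtain ⟨m', n', hmn'⟩ := (h1 _).1 (hc.mul_mem hθ)
  obtain ⟨_, ⟨l, k, rfl⟩, hv⟩ := (hc v).1 ((h1 v).2 ⟨0, 1, by simp⟩)
  obtain ⟨_, ⟨l', k', rfl⟩, hu⟩ := (hc u).1 ((h1 u).2 ⟨1, 0, by simp⟩)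
  refine eq_of_homothetic (c := c / v) (m := m) (n := n) (m' := m') (n' := n') (k := k) (l := l)
    (k' := k') (l' := l') hx h.mem (div_ne_zero hc0 h2) ?_ ?_ ?_ ?_
  · rw [div_eq_iff h2, hmn, h3]; ring
  · rw [div_mul_eq_mul_div, div_eq_iff h2, hmn', h3]; ring
  · rw [inv_div, div_eq_iff hc0, hv]; ring
  · rw [inv_div, div_mul_eq_mul_div, div_eq_iff hc0, ← h3, hu]; ring

theorem exists_int_div_pow (h : SplitRoot ι θ e q) {k : ℕ} {u v : ℂ} (hu : u ∈ primePow ι θ k)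
    (hv : v ∈ primePow ι θ k) :
    ∃ B : ℤ, u * conj v + conj (u * conj v) = (p : ℂ) ^ (2 * k) * B := by
  have hp : (p : ℂ) ≠ 0 := natCast_p_ne_zero
  obtain ⟨t, ht⟩ := h.trace_int (h.int_mul hu.1 (h.int_conj hv.1))
  have h1 : (t : ℂ) / (p : ℂ) ^ (2 * k) ∈ padicRing ι := by
    rw [← ht, map_mul, Complex.conj_conj, add_div, mul_div_right_comm, mul_div_assoc (conj u)]
    exact add_mem (mul_mem hu.2 (h.mem_ring (h.int_conj hv.1)))
      (mul_mem (h.mem_ring (h.int_conj hu.1)) hv.2)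
  obtain ⟨B, rfl⟩ := intCast_div_pow_mem_iff.1 h1
  exact ⟨B, by rw [ht]; push_cast; rfl⟩

/-- The points of the sequence have bounded integral coordinates. -/
theorem exists_coordinates (h : SplitRoot ι θ e q) (k : ℕ) :
    ∃ A B : ℤ, 0 < A ∧ A * (cfX ι θ k).im = 2 * θ.im ∧ A * (cfX ι θ k).re = B ∧
      A ≤ ⌈4 * θ.im⌉ ∧ |B| ≤ A := by
  obtain ⟨u, v, h1, h2, h3, -, h5⟩ := h.exists_basis k
  have hx := mem_fundDomain_iff.1 (h.isSpan_matB k).2.2.2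
  have hu := (h1 u).2 ⟨1, 0, by simp⟩
  have hv := (h1 v).2 ⟨0, 1, by simp⟩
  obtain ⟨A, hA⟩ := h.exists_int_div_pow hv hv
  obtain ⟨B, hB⟩ := h.exists_int_div_pow hu hv
  generalize cfX ι θ k = x at *
  have hpp : (0 : ℝ) < (p : ℝ) ^ (2 * k) := by
    have : (0 : ℝ) < p := by exact_mod_cast (Fact.out : p.Prime).pos
    positivity
  have hcast : ((p : ℂ) ^ (2 * k)) = (((p : ℝ) ^ (2 * k) : ℝ) : ℂ) := by push_cast; rfl
  have hA' : 2 * Complex.normSq v = (p : ℝ) ^ (2 * k) * A := by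
    rw [Complex.add_conj, Complex.mul_conj, Complex.ofReal_re, hcast] at hA
    exact_mod_cast hA
  have hB' : 2 * (Complex.normSq v * x.re) = (p : ℝ) ^ (2 * k) * B := by
    rw [Complex.add_conj, h3, mul_right_comm, Complex.mul_conj, Complex.re_ofReal_mul, hcast] at hB
    exact_mod_cast hB
  have hvpos := Complex.normSq_pos.2 h2
  have hApos : (0 : ℝ) < A := pos_of_mul_pos_right (by rw [← hA']; linarith) hpp.le
  have e1 : A * x.im = 2 * θ.im := by
    apply mul_left_cancel₀ hpp.ne'
    rw [← mul_assoc, ← hA']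
    linear_combination 2 * h5
  have e2 : A * x.re = B := by
    apply mul_left_cancel₀ hpp.ne'
    rw [← mul_assoc, ← hA', ← hB']
    ring
  have hre : |x.re| ≤ 1 / 2 := abs_le.2 ⟨hx.2.1, by rcases hx.2.2 with h | h <;> linarith [h.2]⟩
  refine ⟨A, B, by exact_mod_cast hApos, e1, e2, ?_, ?_⟩
  · have hre2 : x.re ^ 2 ≤ 1 / 4 := by
      rw [← sq_abs]
      have := pow_le_pow_left₀ (abs_nonneg _) hre 2
      linarith
    have him2 : (1 / 2 : ℝ) ≤ x.im := by
      have : 1 ≤ x.re ^ 2 + x.im ^ 2 := by rcases hx.2.2 with h | h <;> linarith [h.1]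
      nlinarith [hx.1]
    have h7 : (A : ℝ) ≤ 4 * θ.im := by nlinarith
    exact_mod_cast h7.trans (Int.le_ceil _)
  · have h7 : |(B : ℝ)| ≤ A := by
      rw [← e2, abs_mul, abs_of_pos hApos]
      nlinarith
    exact_mod_cast h7

theorem exists_cfX_eq_add (h : SplitRoot ι θ e q) :
    ∃ n k : ℕ, 0 < k ∧ cfX ι θ n = cfX ι θ (n + k) := by
  choose A B hA h1 h2 h3 h4 using h.exists_coordinates
  have hnot : ¬ Function.Injective fun n => (A n, B n) := by
    intro hinj
    refine Set.infinite_range_of_injective hinj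
      ((Set.finite_Icc ((0 : ℤ), -⌈4 * θ.im⌉) (⌈4 * θ.im⌉, ⌈4 * θ.im⌉)).subset ?_)
    rintro _ ⟨n, rfl⟩
    have := abs_le.1 ((h4 n).trans (h3 n))
    exact ⟨⟨(hA n).le, this.1⟩, ⟨h3 n, this.2⟩⟩
  obtain ⟨i, j, hij, hne⟩ := Function.not_injective_iff.1 hnot
  rw [Prod.mk.injEq] at hij
  have heq : cfX ι θ i = cfX ι θ j := by
    have hAi : (A i : ℝ) ≠ 0 := by exact_mod_cast (hA i).ne'
    apply Complex.ext
    · apply mul_left_cancel₀ hAi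
      rw [h2 i, hij.2, hij.1, h2 j]
    · apply mul_left_cancel₀ hAi
      rw [h1 i, hij.1, h1 j]
  rcases lt_or_gt_of_ne hne with hlt | hlt
  · exact ⟨i, j - i, by omega, by rw [heq]; congr 1; omega⟩
  · exact ⟨j, i - j, by omega, by rw [← heq]; congr 1; omega⟩

theorem exists_generatedBy (h : SplitRoot ι θ e q) : ∃ k c, 0 < k ∧ GeneratedBy ι θ k c := by
  obtain ⟨n, k, hk, heq⟩ := h.exists_cfX_eq_add
  obtain ⟨u, v, h1, h2, h3, -, -⟩ := h.exists_basis n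
  obtain ⟨u', v', h1', h2', h3', -, -⟩ := h.exists_basis (n + k)
  refine ⟨k, v' / v, hk, h.generatedBy_of_homothetic (n := n) (div_ne_zero h2' h2) fun w => ?_⟩
  rw [h1 w, h1' _]
  refine exists_congr fun a => exists_congr fun b => ?_
  rw [h3', ← heq, h3, div_mul_eq_mul_div, div_eq_iff h2]
  constructor
  · rintro rfl
    ring
  · intro h5
    apply mul_left_cancel₀ h2'
    rw [h5]; ring

/-- The period of the algorithm and the primitive representations of the powers of `p ^ 2` by the
norm form. -/
theorem main (h : SplitRoot ι θ e q) :
    ∃ N : ℕ, IsLeast {n : ℕ | 0 < n ∧ cfX ι θ n = cfX ι θ 0} N ∧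
      ∃ s t : ℤ,
        (s : ℚ) = (p : ℚ) ^ N * ((matB ι θ N)⁻¹).1 1 0 ∧
        (t : ℚ) = (p : ℚ) ^ N * ((matB ι θ N)⁻¹).1 1 1 ∧
        ∀ (x y : ℤ) (ν : ℕ),
          ((IsCoprime x y ∧ x ^ 2 - e * x * y + q * y ^ 2 = (p : ℤ) ^ (2 * ν)) →
            ∃ (ζ : ℂ) (r : ℕ), (IsInt θ ζ ∧ ∃ n : ℕ, 0 < n ∧ ζ ^ n = 1) ∧
              ((x : ℂ) + y * θ = ζ * ((t : ℂ) + s * θ) ^ r ∨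
                (x : ℂ) + y * θ = ζ * (conj ((t : ℂ) + s * θ)) ^ r) ∧ ν = r * N) ∧
          ((∃ (ζ : ℂ) (r : ℕ), (∃ n : ℕ, 0 < n ∧ ζ ^ n = 1) ∧
              ((x : ℂ) + y * θ = ζ * ((t : ℂ) + s * θ) ^ r ∨
                (x : ℂ) + y * θ = ζ * (conj ((t : ℂ) + s * θ)) ^ r) ∧ ν = r * N) →
            (IsCoprime x y ∧ x ^ 2 - e * x * y + q * y ^ 2 = (p : ℤ) ^ (2 * ν))) := by
  have hp : (p : ℂ) ≠ 0 := natCast_p_ne_zero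
  have hX0 : cfX ι θ 0 = θ := rfl
  have hne : {n : ℕ | 0 < n ∧ cfX ι θ n = cfX ι θ 0}.Nonempty := by
    obtain ⟨k, c, hk, hc⟩ := h.exists_generatedBy
    exact ⟨k, hk, h.cfX_eq_of_generatedBy hc⟩
  obtain ⟨N, hN⟩ : ∃ N, IsLeast {n : ℕ | 0 < n ∧ cfX ι θ n = cfX ι θ 0} N :=
    ⟨_, Nat.sInf_mem hne, fun _ hm => Nat.sInf_le hm⟩
  refine ⟨N, hN, ?_⟩
  obtain ⟨⟨hNpos, hNeq⟩, hNmin⟩ := hN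
  rw [hX0] at hNeq
  have hgen := h.generatedBy_of_cfX_eq hNeq
  obtain ⟨u, v, -, -, -, hv, harea⟩ := h.exists_basis N
  rw [hNeq] at harea
  have hnormSq : Complex.normSq v = (p : ℝ) ^ (2 * N) :=
    mul_left_cancel₀ h.im_pos.ne' (by rw [harea]; ring)
  have hnorm : v * conj v = (p : ℂ) ^ (2 * N) := by
    rw [Complex.mul_conj, hnormSq]; push_cast; rfl
  rw [← hv] at hgen
  obtain ⟨t, s, hts⟩ := hgen.self_mem.1
  have hst : (t : ℚ) = (p : ℚ) ^ N * ((matB ι θ N)⁻¹).1 1 1 ∧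
      (s : ℚ) = (p : ℚ) ^ N * ((matB ι θ N)⁻¹).1 1 0 := by
    apply h.rat_unique
    rw [Rat.cast_intCast, Rat.cast_intCast, ← hts, hv, den]
    push_cast
    ring
  refine ⟨s, t, hst.2, hst.1, fun x y ν => ?_⟩
  rw [mul_comm (s : ℂ)] at *
  rw [show (t : ℂ) + θ * s = v by rw [hts]]
  have hv0 := hgen.ne_zero
  have hu : (conj v)⁻¹ ∈ padicRing ι := by
    have hv0' : conj v ≠ 0 := by simpa using hv0
    have h1 : (conj v)⁻¹ = v / (p : ℂ) ^ (2 * N) := by rw [← hnorm]; field_simp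
    rw [h1]
    exact hgen.self_mem.2
  constructor
  · rintro ⟨hcop, hxy⟩
    have hprim : ∃ c, GeneratedBy ι θ ν c := by
      rcases h.generatedBy_or_conj_of_primitive hcop hxy with h1 | h1 <;> exact ⟨_, h1⟩
    obtain ⟨r, hr⟩ : N ∣ ν := by
      obtain ⟨c, hc⟩ := hprim
      have hdm := Nat.div_add_mod' ν N
      rw [← hdm] at hc
      obtain ⟨c'', hc''⟩ := h.exists_generatedBy_sub (h.generatedBy_pow hgen (ν / N)) hc
      by_contra hnd
      have hpos : 0 < ν % N := Nat.pos_of_ne_zero fun h0 => hnd (Nat.dvd_of_mod_eq_zero h0)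
      have := hNmin ⟨hpos, h.cfX_eq_of_generatedBy hc''⟩
      exact absurd (Nat.mod_lt ν hNpos) (not_lt.2 this)
    rw [mul_comm] at hr
    subst hr
    have hvr := h.generatedBy_pow hgen r
    have hvn : ‖v ^ r‖ ^ 2 = (p : ℝ) ^ (2 * (r * N)) := by
      rw [norm_pow, ← pow_mul, mul_comm r 2, pow_mul, Complex.sq_norm, hnormSq, ← pow_mul]
      congr 1; ring
    have hxn : ‖(x + y * θ : ℂ)‖ ^ 2 = (p : ℝ) ^ (2 * (r * N)) := by
      have h1 := h.norm_eq x y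
      rw [hxy, Complex.mul_conj, Complex.normSq_eq_norm_sq] at h1
      exact_mod_cast h1
    have hnn : ‖(x + y * θ : ℂ)‖ = ‖v ^ r‖ :=
      (pow_left_inj₀ (norm_nonneg _) (norm_nonneg _) two_ne_zero).1 (hxn.trans hvn.symm)
    rcases h.generatedBy_or_conj_of_primitive hcop hxy with h1 | h1
    · obtain ⟨ζ, hζ, hζ1, heq⟩ := h.eq_root_of_unity_mul h1 hvr hnn
      exact ⟨ζ, r, ⟨hζ, hζ1⟩, Or.inl heq, rfl⟩
    · obtain ⟨ζ, hζ, ⟨n, hn, hζ1⟩, heq⟩ := h.eq_root_of_unity_mul h1 hvr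
        (by rw [Complex.norm_conj, hnn])
      refine ⟨conj ζ, r, ⟨h.int_conj hζ, n, hn, by rw [← map_pow, hζ1, map_one]⟩, Or.inr ?_, rfl⟩
      have h2 := congrArg conj heq
      rwa [Complex.conj_conj, map_mul, map_pow] at h2
  · rintro ⟨ζ, r, ⟨n, hn, hζ⟩, heq | heq, rfl⟩
    · exact h.isCoprime_of_eq_mul_pow hn hζ hv0 (Or.inr hu) hnorm heq
    · refine h.isCoprime_of_eq_mul_pow hn hζ (by simpa using hv0) (Or.inl hu) ?_ heq
      rw [Complex.conj_conj, mul_comm, hnorm]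

end SplitRoot
end Algorithm
end InftyP

namespace InftyP

/-! ### The generators of the rings of integers -/

theorem sqrtNeg_re (d : ℕ) : (sqrtNeg d).re = 0 := by simp [sqrtNeg]

theorem sqrtNeg_im (d : ℕ) : (sqrtNeg d).im = √d := by simp [sqrtNeg]

theorem theta_mem_fundDomain {d : ℕ} (hd : d ≠ 0) : theta d ∈ fundDomain := by
  have hd1 : (1 : ℝ) ≤ d := by exact_mod_cast Nat.one_le_iff_ne_zero.2 hd
  have hpos : 0 < √(d : ℝ) := Real.sqrt_pos.2 (by linarith)
  have hsq : √(d : ℝ) ^ 2 = d := Real.sq_sqrt (by linarith)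
  rw [mem_fundDomain_iff]
  unfold theta
  split_ifs with hmod
  · have hre : ((-1 + sqrtNeg d) / 2).re = -(1 / 2) := by simp [sqrtNeg_re]; norm_num
    have him : ((-1 + sqrtNeg d) / 2).im = √d / 2 := by simp [sqrtNeg_im]
    have hd3 : (3 : ℝ) ≤ d := by
      have h4 : (4 : ℤ) ∣ 1 - -(d : ℤ) := Int.modEq_iff_dvd.1 hmod
      have : 3 ≤ d := by omega
      exact_mod_cast this
    rw [hre, him, div_pow, hsq]
    refine ⟨by positivity, le_rfl, ?_⟩
    rcases hd3.lt_or_eq with h | h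
    · exact Or.inl ⟨by linarith, by norm_num⟩
    · exact Or.inr ⟨by linarith, by norm_num⟩
  · rw [sqrtNeg_re, sqrtNeg_im, hsq]
    refine ⟨hpos, by norm_num, ?_⟩
    rcases hd1.lt_or_eq with h | h
    · exact Or.inl ⟨by linarith, by norm_num⟩
    · exact Or.inr ⟨by linarith, le_rfl⟩

theorem splitRoot_theta {p : ℕ} [Fact p.Prime] {d : ℕ} (hd : Squarefree d)
    (hsplit : SplitsCompletely p (quadField d)) (ι : ℂ ≃+* PadicAlgCl p) {e q : ℤ}
    (hroot : theta d ^ 2 + e * theta d + q = 0) : SplitRoot ι (theta d) e q := by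
  obtain ⟨a, ha, ha'⟩ := exists_simple_root_of_splits hd hsplit hroot
  refine ⟨hroot, theta_mem_fundDomain hd.ne_zero, mem_padicRing_of_simple_root hroot ha ha',
    fun hdisc => ha' ?_⟩
  refine (Nat.prime_iff_prime_int.1 (Fact.out : p.Prime)).dvd_of_dvd_pow (n := 2) ?_
  have h1 : (2 * a + e) ^ 2 = (e ^ 2 - 4 * q) + 4 * (a ^ 2 + e * a + q) := by ring
  rw [h1]
  exact dvd_add hdisc (Dvd.dvd.mul_left ha _)

theorem IsInt.isRootOfUnityIn {d : ℕ} {ζ : ℂ} (hζ : IsInt (theta d) ζ)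
    (h1 : ∃ n : ℕ, 0 < n ∧ ζ ^ n = 1) : IsRootOfUnityIn d ζ := by
  obtain ⟨m, n, rfl⟩ := hζ
  exact ⟨intCast_add_mul_theta_mem d m n, h1⟩

end InftyP

theorem corollary4p15 (p : ℕ) [Fact p.Prime] (d : ℕ) (hd : Squarefree d)
    (hsplit : InftyP.SplitsCompletely p (InftyP.quadField d))
    (ι : ℂ ≃+* PadicAlgCl p) :
    ∃ N : ℕ,
      IsLeast {n : ℕ | 0 < n ∧
        InftyP.cfX ι (InftyP.theta d) n = InftyP.cfX ι (InftyP.theta d) 0} N ∧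
      ∃ s t : ℤ,
        (s : ℚ) = (p : ℚ) ^ N * ((InftyP.matB ι (InftyP.theta d) N)⁻¹).1 1 0 ∧
        (t : ℚ) = (p : ℚ) ^ N * ((InftyP.matB ι (InftyP.theta d) N)⁻¹).1 1 1 ∧
        (¬ (-(d : ℤ) ≡ 1 [ZMOD 4]) →
          ∀ (x y : ℤ) (ν : ℕ),
            (IsCoprime x y ∧ x ^ 2 + (d : ℤ) * y ^ 2 = (p : ℤ) ^ (2 * ν)) ↔
              ∃ (ζ : ℂ) (r : ℕ), InftyP.IsRootOfUnityIn d ζ ∧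
                ((x : ℂ) + InftyP.sqrtNeg d * y = ζ * ((t : ℂ) + InftyP.sqrtNeg d * s) ^ r ∨
                  (x : ℂ) + InftyP.sqrtNeg d * y = ζ * ((t : ℂ) - InftyP.sqrtNeg d * s) ^ r) ∧
                ν = r * N) ∧
        (-(d : ℤ) ≡ 1 [ZMOD 4] →
          ∀ (x y : ℤ) (ν : ℕ),
            (IsCoprime x y ∧
              4 * x ^ 2 - 4 * x * y + (1 + (d : ℤ)) * y ^ 2 = 4 * (p : ℤ) ^ (2 * ν)) ↔
              ∃ (ζ : ℂ) (r : ℕ), InftyP.IsRootOfUnityIn d ζ ∧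
                ((x : ℂ) + (-1 + InftyP.sqrtNeg d) / 2 * y =
                    ζ * ((t : ℂ) + (-1 + InftyP.sqrtNeg d) / 2 * s) ^ r ∨
                  (x : ℂ) + (-1 + InftyP.sqrtNeg d) / 2 * y =
                    ζ * ((t : ℂ) + (-1 - InftyP.sqrtNeg d) / 2 * s) ^ r) ∧
                ν = r * N) := by
  have hsq := InftyP.sqrtNeg_sq d
  by_cases hmod : -(d : ℤ) ≡ 1 [ZMOD 4]
  · obtain ⟨q, hq⟩ : (4 : ℤ) ∣ 1 - -(d : ℤ) := Int.modEq_iff_dvd.1 hmod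
    have hθ : InftyP.theta d = (-1 + InftyP.sqrtNeg d) / 2 := if_pos hmod
    have hq' : (1 : ℂ) + d = 4 * q := by
      have : (1 : ℤ) + d = 4 * q := by linarith
      exact_mod_cast this
    have h := InftyP.splitRoot_theta hd hsplit ι (e := 1) (q := q) (by
      rw [hθ]; push_cast; linear_combination hsq / 4 - hq' / 4)
    obtain ⟨N, hN, s, t, hs, ht, hmain⟩ := h.main
    refine ⟨N, hN, s, t, hs, ht, fun hn => absurd hmod hn, fun _ x y ν => ?_⟩
    have hc : (starRingEnd ℂ) ((t : ℂ) + s * InftyP.theta d) =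
        t + (-1 - InftyP.sqrtNeg d) / 2 * s := by
      rw [map_add, map_mul, map_intCast, map_intCast, h.conj_eq, hθ]
      push_cast; ring
    have hform : 4 * x ^ 2 - 4 * x * y + (1 + (d : ℤ)) * y ^ 2 = 4 * (p : ℤ) ^ (2 * ν) ↔
        x ^ 2 - 1 * x * y + q * y ^ 2 = (p : ℤ) ^ (2 * ν) := by
      rw [show 4 * x ^ 2 - 4 * x * y + (1 + (d : ℤ)) * y ^ 2 =
        4 * (x ^ 2 - 1 * x * y + q * y ^ 2) by linear_combination y ^ 2 * hq]
      exact mul_right_inj' (by norm_num)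
    obtain ⟨hfwd, hbwd⟩ := hmain x y ν
    rw [hc] at hfwd hbwd
    rw [hform, ← hθ, mul_comm (InftyP.theta d) (y : ℂ), mul_comm (InftyP.theta d) (s : ℂ)]
    constructor
    · intro hxy
      obtain ⟨ζ, r, hζ, hr⟩ := hfwd hxy
      exact ⟨ζ, r, hζ.1.isRootOfUnityIn hζ.2, hr⟩
    · rintro ⟨ζ, r, hζ, hr⟩
      exact hbwd ⟨ζ, r, hζ.2, hr⟩
  · have hθ : InftyP.theta d = InftyP.sqrtNeg d := if_neg hmod
    have h := InftyP.splitRoot_theta hd hsplit ι (e := 0) (q := d) (by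
      rw [hθ]; push_cast; linear_combination hsq)
    obtain ⟨N, hN, s, t, hs, ht, hmain⟩ := h.main
    refine ⟨N, hN, s, t, hs, ht, fun _ x y ν => ?_, fun hn => absurd hn hmod⟩
    have hc : (starRingEnd ℂ) ((t : ℂ) + s * InftyP.theta d) = t - InftyP.sqrtNeg d * s := by
      rw [map_add, map_mul, map_intCast, map_intCast, h.conj_eq, hθ]
      push_cast; ring
    obtain ⟨hfwd, hbwd⟩ := hmain x y ν
    rw [hc, zero_mul, zero_mul, sub_zero] at hfwd hbwd
    rw [← hθ] at hfwd hbwd ⊢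
    rw [mul_comm (InftyP.theta d) (y : ℂ), mul_comm (InftyP.theta d) (s : ℂ)]
    rw [mul_comm (InftyP.theta d) (s : ℂ)] at hfwd hbwd
    constructor
    · intro hxy
      obtain ⟨ζ, r, hζ, hr⟩ := hfwd hxy
      exact ⟨ζ, r, hζ.1.isRootOfUnityIn hζ.2, hr⟩
    · rintro ⟨ζ, r, hζ, hr⟩
      exact hbwd ⟨ζ, r, hζ.2, hr⟩
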